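/- **Setting.** For a finite-dimensional complex vector space $E$ with hermitian inner product $\langle\cdot,\cdot\rangle$ (for instance $\mathbb{C}^n$), let $V(E)$ be the space of alternating bilinear maps $\mu:E\times E\to E$, and write $\mathrm{ad}_\mu X=\mu(X,\cdot)$. Let $\mathrm{Der}(\mu)$ be the set of linear maps $D$ with $D\mu(X,Y)=\mu(DX,Y)+\mu(X,DY)$. For an orthonormal basis $(X_i)$ of $E$ put $\|\mu\|^2=\sum_{i,j}\|\mu(X_i,X_j)\|^2$ and $$R_\mu=-4\sum_i(\mathrm{ad}_\mu X_i)^*\,\mathrm{ad}_\mu X_i+2\sum_i\mathrm{ad}_\mu X_i\,(\mathrm{ad}_\mu X_i)^* .$$ The moment map of the $\mathrm{GL}(E)$-action on $\mathbb{P}V(E)$ is $m([\mu])=R_\mu/\|\mu\|^2$, and $F([\mu])=\|m([\mu])\|^2=\mathrm{tr}(R_\mu^2)/\|\mu\|^4$; write $F_n$ for $F$ if $\dim E=n$. Let $L_n\subset\mathbb{P}V(E)$ be the set of the classes of nonzero Lie brackets. A critical point $[\mu]$ of $F$ has *type* $(k_1<\dots<k_r;d_1,\dots,d_r)$ if $R_\mu=c_\mu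 I+D_\mu$ with $c_\mu\in\mathbb{R}$, $D_\mu\in\mathrm{Der}(\mu)$, and for some $a>0$ the distinct eigenvalues of the diagonalizable map $aD_\mu$ are the nonnegative integers $k_1<\dots<k_r$, with multiplicities $d_1,\dots,d_r\ge 1$, and $\gcd(k_1,\dots,k_r)=1$ if $D_\mu\neq0$. A Lie algebra is *reductive* if its radical is its center, and the *nilradical* is the largest nilpotent ideal. **Theorem.** *(A)* Let $[\mu]\in L_n$ be a critical point of $F_n$ of type $(0<k_2<\dots<k_r;d_1,\dots,d_r)$, and let $E=\mathfrak{g}_1\oplus\dots\oplus\mathfrak{g}_r$ be the eigenspace decomposition of $R_\mu=c_\mu I+D_\mu$ ($\mathfrak g_i$ being the eigenspace of $aD_\mu$ for $k_i$, with $k_1=0$). Then: 1. $\mathfrak{n}=\mathfrak{g}_2\oplus\dots\oplus\mathfrak{g}_r$ is the nilradical of $\mu$, of dimension $m=n-d_1$. If $\mu_{\mathfrak n}=\mu|_{\mathfrak n\times\mathfrak n}$ is not zero, then $[\mu_{\mathfrak n}]$ is a critical point of $F_m$ of type $(k_2<\dots<k_r;d_2,\dots,d_r)$, for the restricted inner product.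 If $\mu_{\mathfrak n}=0$, then $r\le 2$, and $k_2=1$ if $r=2$. 2. $\mathfrak{g}_1$ is a reductive Lie subalgebra of $\mu$. 3. $(\mathrm{ad}_\mu A)^*\in\mathrm{Der}(\mu)$ for every $A\in\mathfrak{g}_1$. *(B)* Conversely, let $[\lambda]\in L_m$ be a critical point of $F_m$ of type $(k_2<\dots<k_r;d_2,\dots,d_r)$, with $\lambda$ a nilpotent Lie bracket on the hermitian space $E'$ of dimension $m$ and $R_\lambda=c_\lambda I+D_\lambda$. Let $\mathfrak{r}\subset\mathrm{Der}(\lambda)$ be a reductive Lie subalgebra of dimension $d_1\ge1$ such that $A^*\in\mathrm{Der}(\lambda)$ for every $A\in\mathfrak r$, $A^*\in\mathfrak r$ for every $A\in[\mathfrak r,\mathfrak r]$, and $AA^*=A^*A$ for every $A$ in the center of $\mathfrak r$. (If $\mathfrak r$ is closed under adjoints, then these three conditions hold.) Then the semidirect product $\mu=[\cdot,\cdot]\ltimes\lambda$ on $\mathfrak r\oplus E'$, that is, $\mu((A,X),(B,Y))=([A,B],\,AY-BX+\lambda(X,Y))$, is a Lie bracket, $$\langle A,B\rangle=-\frac{4}{c_\lambda}\left(\tfrac12\,\mathrm{tr}\,\mathrm{ad}A\,(\mathrm{ad}B)^*+\mathrm{tr}\,AB^*\right),\qquad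 A,B\in\mathfrak r,$$ (where $(\mathrm{ad}B)^*$ is the adjoint of $\mathrm{ad}B:\mathfrak r\to\mathfrak r$ for the inner product $\mathrm{tr}\,AB^*$) together with the given inner product on $E'$ and $\mathfrak r\perp E'$ defines an inner product on $\mathfrak r\oplus E'$, and for this inner product $[\mu]\in L_n$, $n=d_1+m$, is a critical point of $F_n$ of type $(0<k_2<\dots<k_r;d_1,d_2,\dots,d_r)$. -/

import Mathlib

open Module

/-! The commutator bracket on an associative ring, for Lie subalgebras of `gl(E)`. -/
attribute [local instance 100] LieRing.ofAssociativeRing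

/-! ### Skew-symmetric algebras -/

section Algebra

variable {E : Type*} [AddCommGroup E] [Module ℂ E]

/-- The vector space `V(E)` of alternating bilinear maps `E × E → E`. -/
def SkewAlg (E : Type*) [AddCommGroup E] [Module ℂ E] : Submodule ℂ (E →ₗ[ℂ] E →ₗ[ℂ] E) where
  carrier := {μ | ∀ x, μ x x = 0}
  zero_mem' := by intro x; simp
  add_mem' := by
    intro a b ha hb x
    have h1 := ha x
    have h2 := hb x
    simp [h1, h2]
  smul_mem' := by
    intro c a ha x
    have h1 := ha x
    simp [h1]

/-- `ad_μ X : Y ↦ μ(X, Y)`. -/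
def adOp (μ : SkewAlg E) (x : E) : E →ₗ[ℂ] E := μ.1 x

theorem adOp_self (μ : SkewAlg E) (x : E) : adOp μ x x = 0 := μ.2 x

theorem adOp_swap (μ : SkewAlg E) (x y : E) : adOp μ x y = -adOp μ y x := by
  have h : adOp μ (x + y) (x + y) = 0 := adOp_self μ _
  have e : adOp μ (x + y) (x + y)
      = adOp μ x x + adOp μ y x + (adOp μ x y + adOp μ y y) := by
    simp only [adOp, map_add, LinearMap.add_apply]
  rw [e, adOp_self, adOp_self, zero_add, add_zero, add_comm] at h
  exact eq_neg_of_add_eq_zero_left h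

/-- `D ∈ Der(μ)`. -/
def IsDerivation (μ : SkewAlg E) (D : E →ₗ[ℂ] E) : Prop :=
  ∀ x y, D (adOp μ x y) = adOp μ (D x) y + adOp μ x (D y)

/-- The Jacobi identity (in Leibniz form). -/
def IsLieBracket (μ : SkewAlg E) : Prop :=
  ∀ x y z, adOp μ x (adOp μ y z) = adOp μ (adOp μ x y) z + adOp μ y (adOp μ x z)

/-- The set of all Lie brackets on the vector space `E`. -/
def LieBracket (E : Type*) [AddCommGroup E] [Module ℂ E] : Type _ :=
  {μ : SkewAlg E // IsLieBracket μ}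

/-- The vector space `E`, regarded as a Lie algebra by means of the bracket `μ`. -/
def LieAlg (_μ : LieBracket E) : Type _ := E

instance (μ : LieBracket E) : AddCommGroup (LieAlg μ) := inferInstanceAs (AddCommGroup E)

instance (μ : LieBracket E) : Module ℂ (LieAlg μ) := inferInstanceAs (Module ℂ E)

/-- The identity map from `E` to the Lie algebra `(E, μ)`. -/
def LieAlg.of (μ : LieBracket E) : E ≃ₗ[ℂ] LieAlg μ := LinearEquiv.refl ℂ E

instance (μ : LieBracket E) : LieRing (LieAlg μ) where
  bracket x y := LieAlg.of μ (adOp μ.1 ((LieAlg.of μ).symm x) ((LieAlg.of μ).symm y))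
  add_lie x y z := by
    change LieAlg.of μ _ = LieAlg.of μ _ + LieAlg.of μ _
    simp [adOp]
  lie_add x y z := by
    change LieAlg.of μ _ = LieAlg.of μ _ + LieAlg.of μ _
    simp [adOp]
  lie_self x := by
    change LieAlg.of μ _ = 0
    rw [adOp_self, map_zero]
  leibniz_lie x y z := by
    change LieAlg.of μ _ = LieAlg.of μ _ + LieAlg.of μ _
    rw [← map_add]
    exact congrArg _ (μ.2 _ _ _)

instance (μ : LieBracket E) : LieAlgebra ℂ (LieAlg μ) where
  lie_smul t x y := by
    change LieAlg.of μ _ = t • LieAlg.of μ _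
    simp [adOp]

/-- The subspace `N` is the nilradical of `μ`: it is the largest among the ideals which are
nilpotent as Lie algebras. -/
def IsNilradical (μ : LieBracket E) (N : Submodule ℂ E) : Prop :=
  ∃ I : LieIdeal ℂ (LieAlg μ), I.toSubmodule = N.map (LieAlg.of μ).toLinearMap ∧
    IsGreatest {J : LieIdeal ℂ (LieAlg μ) | LieRing.IsNilpotent J} I

/-- The subspace `S` is a reductive Lie subalgebra of `μ` (reductive: the radical is the
center). -/
def IsReductiveSubalgebra (μ : LieBracket E) (S : Submodule ℂ E) : Prop :=
  ∃ h : LieSubalgebra ℂ (LieAlg μ), h.toSubmodule = S.map (LieAlg.of μ).toLinearMap ∧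
    LieAlgebra.HasCentralRadical ℂ h

/-- The restriction `μ|_{N × N}` to a subspace `N` which is closed under `μ`. -/
def restrictAlg (μ : SkewAlg E) (N : Submodule ℂ E)
    (hN : ∀ x ∈ N, ∀ y ∈ N, adOp μ x y ∈ N) : SkewAlg N :=
  ⟨LinearMap.mk₂ ℂ (fun x y : N => (⟨adOp μ x y, hN x x.2 y y.2⟩ : N))
    (fun x y z => by ext; simp [adOp]) (fun t x y => by ext; simp [adOp])
    (fun x y z => by ext; simp [adOp]) (fun t x y => by ext; simp [adOp]),
   fun x => by ext; simp [adOp_self]⟩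

/-- The bracket of the semidirect product `r ⋉ λ`, for a Lie subalgebra `r` of `gl(E)`:
`μ((A, X), (B, Y)) = ([A, B], A Y - B X + λ(X, Y))`. -/
def semidirect (r : LieSubalgebra ℂ (Module.End ℂ E)) (lam : SkewAlg E) : SkewAlg (r × E) :=
  ⟨LinearMap.mk₂ ℂ
    (fun x y : r × E =>
      (⁅x.1, y.1⁆, (x.1 : Module.End ℂ E) y.2 - (y.1 : Module.End ℂ E) x.2 + adOp lam x.2 y.2))
    (fun x y z => by
      ext1
      · simp
      · simp [adOp]; abel)
    (fun t x y => by
      ext1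
      · simp
      · simp [adOp, smul_sub])
    (fun x y z => by
      ext1
      · simp
      · simp [adOp]; abel)
    (fun t x y => by
      ext1
      · simp
      · simp [adOp, smul_sub]),
   fun x => by
    ext1
    · simp
    · simp [adOp_self]⟩

end Algebra

/-! ### The moment map and its square norm -/

noncomputable section Moment

variable {E : Type*} [NormedAddCommGroup E] [InnerProductSpace ℂ E] [FiniteDimensional ℂ E]

/-- `‖μ‖² = ∑ ‖μ(X_i, X_j)‖²`, for an orthonormal basis `(X_i)` of `E`. -/
def normSqAlg (μ : SkewAlg E) : ℝ :=
  ∑ i, ∑ j, ‖adOp μ (stdOrthonormalBasis ℂ E i) (stdOrthonormalBasis ℂ E j)‖ ^ 2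

/-- `R_μ = -4 ∑ (ad X_i)^* ad X_i + 2 ∑ ad X_i (ad X_i)^*`, for an orthonormal basis `(X_i)`. -/
def opR (μ : SkewAlg E) : E →ₗ[ℂ] E :=
  (-4 : ℂ) • ∑ i, LinearMap.adjoint (adOp μ (stdOrthonormalBasis ℂ E i)) ∘ₗ
      adOp μ (stdOrthonormalBasis ℂ E i) +
  (2 : ℂ) • ∑ i, adOp μ (stdOrthonormalBasis ℂ E i) ∘ₗ
      LinearMap.adjoint (adOp μ (stdOrthonormalBasis ℂ E i))

/-- The moment map at the point `[μ]` of projective space (for `μ ≠ 0`). -/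
def momentMap (μ : SkewAlg E) : E →ₗ[ℂ] E := ((normSqAlg μ : ℂ)⁻¹) • opR μ

/-- `R_μ`, hence also the moment map, is hermitian. -/
theorem opR_adjoint (μ : SkewAlg E) : LinearMap.adjoint (opR μ) = opR μ := by
  rw [opR, map_add, map_smulₛₗ, map_smulₛₗ, map_sum, map_sum]
  have h4 : (starRingEnd ℂ) 4 = 4 := Complex.conj_ofNat 4
  have h2 : (starRingEnd ℂ) 2 = 2 := Complex.conj_ofNat 2
  simp only [LinearMap.adjoint_comp, LinearMap.adjoint_adjoint, map_neg, h4, h2]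

/-- `R_μ / ‖μ‖²` is indeed the moment map of the action `g·μ = g μ(g⁻¹ ·, g⁻¹ ·)`: the infinitesimal
action is `A·μ = A μ(·, ·) - μ(A ·, ·) - μ(·, A ·)`, the derivative of `g ↦ ‖g·μ‖²` at the identity
in the direction `A` is `2 Re ⟨A·μ, μ⟩`, and this is `Re tr (R_μ A)`. -/
theorem trace_opR_comp (μ : SkewAlg E) (A : E →ₗ[ℂ] E) :
    LinearMap.trace ℂ E (opR μ ∘ₗ A) =
      2 * ∑ i, ∑ j, inner ℂ
        (adOp μ (stdOrthonormalBasis ℂ E i) (stdOrthonormalBasis ℂ E j))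
        (A (adOp μ (stdOrthonormalBasis ℂ E i) (stdOrthonormalBasis ℂ E j))
          - adOp μ (A (stdOrthonormalBasis ℂ E i)) (stdOrthonormalBasis ℂ E j)
          - adOp μ (stdOrthonormalBasis ℂ E i) (A (stdOrthonormalBasis ℂ E j))) := by
  set b := stdOrthonormalBasis ℂ E
  have h1 : LinearMap.trace ℂ E
      ((∑ i, LinearMap.adjoint (adOp μ (b i)) ∘ₗ adOp μ (b i)) ∘ₗ A)
      = ∑ i, ∑ j, inner ℂ (adOp μ (b i) (b j)) (adOp μ (b i) (A (b j))) := by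
    rw [LinearMap.trace_eq_sum_inner _ b, Finset.sum_comm]
    refine Finset.sum_congr rfl fun j _ => ?_
    simp [inner_sum, LinearMap.adjoint_inner_right]
  have h2 : LinearMap.trace ℂ E
      ((∑ i, adOp μ (b i) ∘ₗ LinearMap.adjoint (adOp μ (b i))) ∘ₗ A)
      = ∑ i, ∑ j, inner ℂ (adOp μ (b i) (b j)) (A (adOp μ (b i) (b j))) := by
    have : (∑ i, adOp μ (b i) ∘ₗ LinearMap.adjoint (adOp μ (b i))) ∘ₗ A
        = ∑ i, adOp μ (b i) ∘ₗ (LinearMap.adjoint (adOp μ (b i)) ∘ₗ A) := by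
      ext x; simp [LinearMap.sum_apply]
    rw [this, map_sum]
    refine Finset.sum_congr rfl fun i _ => ?_
    rw [LinearMap.trace_comp_comm', LinearMap.trace_eq_sum_inner _ b]
    simp [LinearMap.adjoint_inner_right]
  have h3 : ∑ i, ∑ j, inner ℂ (adOp μ (b i) (b j)) (adOp μ (A (b i)) (b j))
      = ∑ i, ∑ j, inner ℂ (adOp μ (b i) (b j)) (adOp μ (b i) (A (b j))) := by
    rw [Finset.sum_comm]
    refine Finset.sum_congr rfl fun i _ => Finset.sum_congr rfl fun j _ => ?_
    rw [adOp_swap μ (b j), adOp_swap μ (A (b j)), inner_neg_neg]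
  have h4 : LinearMap.trace ℂ E (opR μ ∘ₗ A)
      = (-4 : ℂ) * LinearMap.trace ℂ E
          ((∑ i, LinearMap.adjoint (adOp μ (b i)) ∘ₗ adOp μ (b i)) ∘ₗ A)
        + 2 * LinearMap.trace ℂ E
          ((∑ i, adOp μ (b i) ∘ₗ LinearMap.adjoint (adOp μ (b i))) ∘ₗ A) := by
    rw [opR, LinearMap.add_comp, map_add, LinearMap.smul_comp, LinearMap.smul_comp, map_smul,
      map_smul, smul_eq_mul, smul_eq_mul]
  rw [h4, h1, h2]
  simp only [inner_sub_right, Finset.sum_sub_distrib]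
  rw [h3]
  ring

/-- The functional `F([μ]) = ‖m([μ])‖² = tr (m([μ])²)`, as a function of `μ ≠ 0`; it is equal to
`tr (R_μ²)` when `‖μ‖ = 1`. -/
def funF (μ : SkewAlg E) : ℝ := (LinearMap.trace ℂ E (momentMap μ ∘ₗ momentMap μ)).re

theorem momentMap_smul (t : ℂ) (ht : t ≠ 0) (μ : SkewAlg E) :
    momentMap (t • μ) = momentMap μ := by
  have h0 : ∀ x, adOp (t • μ) x = t • adOp μ x := fun x => rfl
  have h1 : normSqAlg (t • μ) = ‖t‖ ^ 2 * normSqAlg μ := by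
    simp [normSqAlg, h0, norm_smul, mul_pow, Finset.mul_sum]
  have h2 : opR (t • μ) = ((‖t‖ ^ 2 : ℝ) : ℂ) • opR μ := by
    have hc : (starRingEnd ℂ) t * t = ((‖t‖ ^ 2 : ℝ) : ℂ) := by
      rw [Complex.conj_mul']; push_cast; rfl
    have hc' : t * (starRingEnd ℂ) t = ((‖t‖ ^ 2 : ℝ) : ℂ) := by rw [mul_comm, hc]
    simp only [opR, h0, map_smulₛₗ, LinearMap.comp_smul, LinearMap.smul_comp, smul_smul,
      ← Finset.smul_sum, hc, hc', smul_add, mul_comm]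
  have h3 : ((‖t‖ ^ 2 : ℝ) : ℂ) ≠ 0 := by
    exact_mod_cast pow_ne_zero 2 (norm_ne_zero_iff.mpr ht)
  rw [momentMap, momentMap, h1, h2, smul_smul, Complex.ofReal_mul, mul_inv, mul_right_comm,
    inv_mul_cancel₀ h3, one_mul]

/-- `F` only depends on the class of `μ` in projective space. -/
theorem funF_smul (t : ℂ) (ht : t ≠ 0) (μ : SkewAlg E) : funF (t • μ) = funF μ := by
  rw [funF, funF, momentMap_smul t ht]

/-- `[μ]` is a critical point of the functional `F` on the projective space of `V(E)`.  As `F` is a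
smooth function, this says that its derivative at `μ` vanishes in every direction. -/
def IsCriticalPoint (μ : SkewAlg E) : Prop :=
  μ ≠ 0 ∧ ∀ ν : SkewAlg E, HasDerivAt (fun t : ℝ => funF (μ + (t : ℂ) • ν)) 0 0

/-- `R_μ = c I + D` with `D ∈ Der(μ)`, and `a > 0` is such that the eigenvalues of `a D` are the
nonnegative integers `k_1 < ... < k_r`, prime to each other, with multiplicities `d_1, ..., d_r`.
(If `D = 0` then the only eigenvalue is `0`, with multiplicity the dimension of `E`.) -/
structure IsTypeData (μ : SkewAlg E) (c a : ℝ) (D : E →ₗ[ℂ] E) {r : ℕ} (k d : Fin r → ℕ) :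
    Prop where
  opR_eq : opR μ = (c : ℂ) • LinearMap.id + D
  isDerivation : IsDerivation μ D
  a_pos : 0 < a
  k_strictMono : StrictMono k
  k_coprime : D ≠ 0 → Finset.univ.gcd k = 1
  d_pos : ∀ i, 0 < d i
  finrank_eigenspace : ∀ i, finrank ℂ (End.eigenspace ((a : ℂ) • D) (k i : ℂ)) = d i
  sum_d : ∑ i, d i = finrank ℂ E

/-- `[μ]` is a critical point of `F` of type `(k_1 < ... < k_r; d_1, ..., d_r)`. -/
def IsCriticalOfType (μ : SkewAlg E) {r : ℕ} (k d : Fin r → ℕ) : Prop :=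
  IsCriticalPoint μ ∧ ∃ (c a : ℝ) (D : E →ₗ[ℂ] E), IsTypeData μ c a D k d

end Moment

/-- The same notion, for a vector space with a given (positive definite hermitian) inner product. -/
def IsCriticalOfTypeWrt {W : Type*} [AddCommGroup W] [Module ℂ W] [FiniteDimensional ℂ W]
    (ip : InnerProductSpace.Core ℂ W) (μ : SkewAlg W) {r : ℕ} (k d : Fin r → ℕ) : Prop :=
  letI : NormedAddCommGroup W := ip.toNormedAddCommGroup
  letI : InnerProductSpace ℂ W := InnerProductSpace.ofCore ip.toCore
  IsCriticalOfType (E := W) μ k d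

/-! ### The inner product on a subalgebra of `gl(E)` -/

noncomputable section HilbertSchmidt

variable {E : Type*} [NormedAddCommGroup E] [InnerProductSpace ℂ E] [FiniteDimensional ℂ E]

theorem trace_adjoint (T : E →ₗ[ℂ] E) :
    LinearMap.trace ℂ E (LinearMap.adjoint T) = (starRingEnd ℂ) (LinearMap.trace ℂ E T) := by
  rw [LinearMap.trace_eq_sum_inner _ (stdOrthonormalBasis ℂ E),
    LinearMap.trace_eq_sum_inner _ (stdOrthonormalBasis ℂ E), map_sum]
  exact Finset.sum_congr rfl fun i _ => by
    rw [LinearMap.adjoint_inner_right, inner_conj_symm]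

theorem trace_comp_adjoint (T : E →ₗ[ℂ] E) :
    LinearMap.trace ℂ E (T ∘ₗ LinearMap.adjoint T) =
      ((∑ i, ‖T (stdOrthonormalBasis ℂ E i)‖ ^ 2 : ℝ) : ℂ) := by
  rw [LinearMap.trace_comp_comm', LinearMap.trace_eq_sum_inner _ (stdOrthonormalBasis ℂ E)]
  push_cast
  exact Finset.sum_congr rfl fun i _ => by
    change inner ℂ _ (LinearMap.adjoint T (T _)) = _
    rw [LinearMap.adjoint_inner_right, inner_self_eq_norm_sq_to_K]
    rfl

/-- The inner product `⟨A, B⟩ = tr (A B^*)` on a Lie subalgebra of `gl(E)`.  (Mathlib's inner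
products are linear in the second variable, so `inner A B` is `tr (B A^*)`.) -/
@[reducible] def traceCore (r : LieSubalgebra ℂ (Module.End ℂ E)) :
    InnerProductSpace.Core ℂ r where
  inner A B := LinearMap.trace ℂ E ((B : E →ₗ[ℂ] E) ∘ₗ LinearMap.adjoint (A : E →ₗ[ℂ] E))
  conj_inner_symm A B := by
    rw [← trace_adjoint, LinearMap.adjoint_comp, LinearMap.adjoint_adjoint]
  re_inner_nonneg A := by
    rw [trace_comp_adjoint, RCLike.re_eq_complex_re, Complex.ofReal_re]
    positivity
  add_left A B C := by
    simp [LinearMap.comp_add]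
  smul_left A B t := by
    change LinearMap.trace ℂ E ((B : E →ₗ[ℂ] E) ∘ₗ LinearMap.adjoint (t • (A : E →ₗ[ℂ] E))) = _
    rw [map_smulₛₗ, LinearMap.comp_smul, map_smul, smul_eq_mul]
  definite A hA := by
    rw [trace_comp_adjoint, Complex.ofReal_eq_zero,
      Finset.sum_eq_zero_iff_of_nonneg (fun i _ => by positivity)] at hA
    apply Subtype.ext
    refine (stdOrthonormalBasis ℂ E).toBasis.ext fun i => ?_
    simpa using hA i (Finset.mem_univ i)

/-- The adjoint of an operator on `r` with respect to the inner product `tr (A B^*)`. -/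
def traceAdjoint (r : LieSubalgebra ℂ (Module.End ℂ E)) (T : r →ₗ[ℂ] r) : r →ₗ[ℂ] r :=
  letI : NormedAddCommGroup r := (traceCore r).toNormedAddCommGroup
  letI : InnerProductSpace ℂ r := InnerProductSpace.ofCore (traceCore r).toCore
  LinearMap.adjoint T

theorem traceAdjoint_spec (r : LieSubalgebra ℂ (Module.End ℂ E)) (T : r →ₗ[ℂ] r) (A B : r) :
    LinearMap.trace ℂ E ((T A : E →ₗ[ℂ] E) ∘ₗ LinearMap.adjoint (B : E →ₗ[ℂ] E)) =
      LinearMap.trace ℂ E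
        ((A : E →ₗ[ℂ] E) ∘ₗ LinearMap.adjoint (traceAdjoint r T B : E →ₗ[ℂ] E)) := by
  let : NormedAddCommGroup r := (traceCore r).toNormedAddCommGroup
  let : InnerProductSpace ℂ r := InnerProductSpace.ofCore (traceCore r).toCore
  exact (LinearMap.adjoint_inner_left T A B).symm

/-- The form `⟨A, B⟩ = -(4/c) (½ tr (ad A (ad B)^*) + tr (A B^*))` on `r`, linear in `A` and
conjugate-linear in `B`. -/
def reductiveForm (c : ℝ) (r : LieSubalgebra ℂ (Module.End ℂ E)) (A B : r) : ℂ :=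
  -(4 / (c : ℂ)) *
    (1 / 2 * LinearMap.trace ℂ r
        (LieAlgebra.ad ℂ r A ∘ₗ traceAdjoint r (LieAlgebra.ad ℂ r B)) +
      LinearMap.trace ℂ E ((A : E →ₗ[ℂ] E) ∘ₗ LinearMap.adjoint (B : E →ₗ[ℂ] E)))

end HilbertSchmidt

/-! ### A trace criterion for the radical to be the center. -/

section PureAlgebra

/-! Write A·μ for the infinitesimal action (`act`). Everything rests on the moment map identity
tr(R_μ A) = 2⟨μ, A·μ⟩ and on the fact that A and A^* act on V(E) by mutually adjoint operators
(`innerAlg_act_adjoint`). For a derivation A they give tr(R_μ [A, A^*]) = 2‖A^*·μ‖². If A commutes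
with D, hence with R_μ = cI + D, the left side vanishes and A^* is a derivation
(`isDerivation_adjoint`); for A = ad X with DX = 0 this is (A)3. Taking A = R_μ gives tr R_μ² =
-2c‖μ‖², so c < 0 (`scalar_neg`), and polarization shows that R_μ = cI + D with D a derivation
suffices for criticality (`isCriticalPoint_of_derivation`). Both directions thus reduce to computing
R.

Suppose that g is a subalgebra, its orthogonal complement is an ideal, and the adjoints of ad A, A
in g, are derivations (`IsAdjointSplitting`). For an orthonormal basis (a_i) of g one then has ∑ (ad
a_i)^* ad a_i = ∑ ad a_i (ad a_i)^* (`sum_adjoint_mul`), and the contributions of g to R on the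
complement cancel (`inner_opR_right_right`). In (A) the nilradical therefore inherits c and D. In
(B) the inner product on r is the one that makes R_μ equal to c on r, and the mixed terms vanish
because D is onto and commutes with r and its adjoints. The hypotheses on r enter through
`exists_lie_adjoint_eq`: on r, bracketing with A^* agrees with bracketing with an element of r.

Reductivity of g_1 follows from `hasCentralRadical_of_trace`, tested on the derivation (ad A)^*. The
elements of positive degree form a nilpotent ideal. An element of a nilpotent ideal has a
degree-zero part A which is central in g_1 with ad A nilpotent; moreover ad A is normal, hence zero,
and c < 0 forbids a nonzero central element of degree zero. -/

theorem LinearMap.trace_eq_zero_of_isNilpotent {K V : Type*} [Field K] [AddCommGroup V] [Module K V]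
    [FiniteDimensional K V] {f : V →ₗ[K] V} (h : IsNilpotent (f : End K V)) :
    LinearMap.trace K V f = 0 :=
  (LinearMap.isNilpotent_trace_of_isNilpotent h).eq_zero

variable {K L : Type*} [Field K] [LieRing L] [LieAlgebra K L] [FiniteDimensional K L]

/-- Derivations preserve the center, so ad x ∘ T has square zero when ad x takes central values, and
the trace condition holds automatically. -/
theorem mem_center_of_lie_mem_center
    (h : ∀ x : L, (∀ T : L →ₗ[K] L, (∀ a b, T ⁅a, b⁆ = ⁅T a, b⁆ + ⁅a, T b⁆) →
      LinearMap.trace K L (LieAlgebra.ad K L x ∘ₗ T) = 0) → x ∈ LieAlgebra.center K L)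
    {x : L} (hx : ∀ y : L, ⁅y, x⁆ ∈ LieAlgebra.center K L) : x ∈ LieAlgebra.center K L := by
  refine h x fun T hT => LinearMap.trace_eq_zero_of_isNilpotent ⟨2, ?_⟩
  have hz : ∀ z ∈ LieAlgebra.center K L, ∀ y : L, ⁅y, z⁆ = 0 := fun z hz =>
    (LieModule.mem_maxTrivSubmodule K L L z).1 hz
  ext v
  have h1 : ∀ w, ⁅x, w⁆ ∈ LieAlgebra.center K L := fun w => by
    rw [← lie_skew]; exact neg_mem (hx w)
  have h2 : T ⁅x, T v⁆ ∈ LieAlgebra.center K L := by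
    refine (LieModule.mem_maxTrivSubmodule K L L _).2 fun y => ?_
    have := hT y ⁅x, T v⁆
    rw [hz _ (h1 _), map_zero, hz _ (h1 _), zero_add] at this
    exact this.symm
  simpa [pow_two] using hz _ h2 x

/-- Cyclicity of the trace together with ad (T y) = [T, ad y]. -/
theorem trace_ad_comp_lie (s y : L) (T : L →ₗ[K] L) (hT : ∀ a b, T ⁅a, b⁆ = ⁅T a, b⁆ + ⁅a, T b⁆) :
    LinearMap.trace K L (LieAlgebra.ad K L ⁅s, y⁆ ∘ₗ T)
      = - LinearMap.trace K L (LieAlgebra.ad K L s ∘ₗ LieAlgebra.ad K L (T y)) := by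
  have e1 : LieAlgebra.ad K L ⁅s, y⁆ ∘ₗ T
      = LieAlgebra.ad K L s ∘ₗ (LieAlgebra.ad K L y ∘ₗ T)
        - LieAlgebra.ad K L y ∘ₗ (LieAlgebra.ad K L s ∘ₗ T) := by
    ext v; simp
  have e2 : LieAlgebra.ad K L (T y) = T ∘ₗ LieAlgebra.ad K L y - LieAlgebra.ad K L y ∘ₗ T := by
    ext v; simp [hT]
  rw [e1, e2, map_sub, LinearMap.comp_sub, map_sub,
    LinearMap.trace_comp_comm' (LieAlgebra.ad K L s ∘ₗ T) (LieAlgebra.ad K L y), LinearMap.comp_assoc]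
  ring

/-- Induction on the derived length. Once [S, S] is central, each [x, y] with x in S passes the
trace test, because ad x ∘ ad (T y) is nilpotent; then x has central brackets and is itself central.
-/
theorem le_center_of_derivedSeries_eq_bot
    (h : ∀ x : L, (∀ T : L →ₗ[K] L, (∀ a b, T ⁅a, b⁆ = ⁅T a, b⁆ + ⁅a, T b⁆) →
      LinearMap.trace K L (LieAlgebra.ad K L x ∘ₗ T) = 0) → x ∈ LieAlgebra.center K L)
    (k : ℕ) (S : LieIdeal K L) (hS : LieAlgebra.derivedSeriesOfIdeal K L k S = ⊥) :
    S ≤ LieAlgebra.center K L := by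
  induction k generalizing S with
  | zero =>
    rw [LieAlgebra.derivedSeriesOfIdeal_zero] at hS
    rw [hS]; exact bot_le
  | succ k ih =>
    have hz : ∀ z ∈ LieAlgebra.center K L, ∀ y : L, ⁅y, z⁆ = 0 := fun z hz =>
      (LieModule.mem_maxTrivSubmodule K L L z).1 hz
    have hSS : ⁅S, S⁆ ≤ LieAlgebra.center K L := by
      refine ih ⁅S, S⁆ ?_
      rw [← hS, LieAlgebra.derivedSeriesOfIdeal_add S k 1]
      simp
    have hSS' : ∀ a ∈ S, ∀ b ∈ S, ⁅a, b⁆ ∈ LieAlgebra.center K L := fun a ha b hb =>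
      hSS (LieSubmodule.lie_mem_lie ha hb)
    intro x hx
    have key : ∀ y, ⁅x, y⁆ ∈ LieAlgebra.center K L := by
      refine fun y => h _ fun T hT => ?_
      rw [trace_ad_comp_lie _ _ _ hT, neg_eq_zero]
      -- One factor ad x ∘ ad (T y) leads into S, a second one into [S, S], which is central, and
      -- the third kills it.
      refine LinearMap.trace_eq_zero_of_isNilpotent ⟨3, ?_⟩
      ext v
      have h1 : ∀ w, ⁅x, w⁆ ∈ S := fun w => lie_mem_left K L S x w hx
      have h2 : ⁅x, ⁅T y, ⁅x, ⁅T y, v⁆⁆⁆⁆ ∈ LieAlgebra.center K L :=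
        hSS' _ hx _ (S.lie_mem (h1 _))
      simp [pow_succ, hz _ h2]
    exact mem_center_of_lie_mem_center h fun y => by
      rw [← lie_skew]; exact neg_mem (key y)

/-- The hypothesis says that the pairing (x, T) ↦ tr (ad x ∘ T) with derivations detects every
noncentral x. If the adjoint of each ad x is a derivation, T = (ad x)^* does this. -/
theorem hasCentralRadical_of_trace
    (h : ∀ x : L, (∀ T : L →ₗ[K] L, (∀ a b, T ⁅a, b⁆ = ⁅T a, b⁆ + ⁅a, T b⁆) →
      LinearMap.trace K L (LieAlgebra.ad K L x ∘ₗ T) = 0) → x ∈ LieAlgebra.center K L) :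
    LieAlgebra.HasCentralRadical K L := by
  refine LieAlgebra.hasCentralRadical_of_radical_le K L ?_
  obtain ⟨k, hk⟩ := LieAlgebra.IsSolvable.solvable (R := K) (L := LieAlgebra.radical K L)
  rw [LieIdeal.derivedSeries_eq_bot_iff] at hk
  exact le_center_of_derivedSeries_eq_bot h k _ hk

end PureAlgebra

/-! ### Operators commuting with a normal operator. -/

section Fuglede

variable {F : Type*} [NormedAddCommGroup F] [InnerProductSpace ℂ F] [FiniteDimensional ℂ F]

theorem eq_zero_of_trace_comp_adjoint {T : F →ₗ[ℂ] F}
    (h : LinearMap.trace ℂ F (T * LinearMap.adjoint T) = 0) : T = 0 := by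
  change LinearMap.trace ℂ F (T ∘ₗ LinearMap.adjoint T) = 0 at h
  rw [trace_comp_adjoint, Complex.ofReal_eq_zero,
    Finset.sum_eq_zero_iff_of_nonneg (fun i _ => by positivity)] at h
  refine (stdOrthonormalBasis ℂ F).toBasis.ext fun i => ?_
  simpa using h i (Finset.mem_univ i)

theorem adjoint_mul (A B : End ℂ F) :
    LinearMap.adjoint (A * B) = (LinearMap.adjoint B * LinearMap.adjoint A : End ℂ F) :=
  LinearMap.adjoint_comp A B

/-- Fuglede's theorem in finite dimension. -/
theorem adjoint_mul_comm_of_normal {C B : End ℂ F}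
    (hC : C * LinearMap.adjoint C = LinearMap.adjoint C * C) (hCB : C * B = B * C) :
    LinearMap.adjoint C * B = B * LinearMap.adjoint C := by
  rw [← sub_eq_zero]
  -- The squared Hilbert–Schmidt norm of the commutator expands into four traces, each equal to tr
  -- (C^* C B B^*) up to sign, and the signs cancel.
  apply eq_zero_of_trace_comp_adjoint
  have hBC : LinearMap.adjoint B * LinearMap.adjoint C = LinearMap.adjoint C * LinearMap.adjoint B := by
    rw [← adjoint_mul, hCB, adjoint_mul]
  rw [map_sub, adjoint_mul, adjoint_mul, LinearMap.adjoint_adjoint]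
  set c : End ℂ F := LinearMap.adjoint C
  set b : End ℂ F := LinearMap.adjoint B
  have e1 : LinearMap.trace ℂ F (c * B * (b * C)) = LinearMap.trace ℂ F (c * C * (B * b)) := by
    rw [← mul_assoc (c * B), LinearMap.trace_mul_comm, ← hC]
    simp only [mul_assoc]
  have e2 : c * B * (C * b) = c * C * (B * b) := by
    rw [mul_assoc, ← mul_assoc B C, ← hCB]; simp only [mul_assoc]
  have e3 : LinearMap.trace ℂ F (B * c * (b * C)) = LinearMap.trace ℂ F (c * C * (B * b)) := by
    rw [mul_assoc B c, ← mul_assoc c b, ← hBC, LinearMap.trace_mul_comm ℂ (c * C)]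
    simp only [mul_assoc]
  have e4 : LinearMap.trace ℂ F (B * c * (C * b)) = LinearMap.trace ℂ F (c * C * (B * b)) := by
    rw [mul_assoc B c, ← mul_assoc c C, ← hC, mul_assoc C c, ← hBC, ← mul_assoc B C, ← hCB,
      show C * B * (b * c) = C * (B * b) * c by simp only [mul_assoc], LinearMap.trace_mul_comm, ← mul_assoc, ← hC, mul_assoc]
  rw [sub_mul, mul_sub, mul_sub, map_sub, map_sub, map_sub, e1, e2, e3, e4]
  ring

end Fuglede

/-! ### The infinitesimal action on brackets, the moment map and critical points. -/

section Moment

variable {E : Type*} [NormedAddCommGroup E] [InnerProductSpace ℂ E]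

theorem adOp_add_left (μ : SkewAlg E) (x y : E) : adOp μ (x + y) = adOp μ x + adOp μ y :=
  map_add μ.1 x y

theorem adOp_sub_left (μ : SkewAlg E) (x y : E) : adOp μ (x - y) = adOp μ x - adOp μ y :=
  map_sub μ.1 x y

theorem adOp_smul_left (μ : SkewAlg E) (t : ℂ) (x : E) : adOp μ (t • x) = t • adOp μ x :=
  map_smul μ.1 t x

theorem adOp_zero_left (μ : SkewAlg E) : adOp μ (0 : E) = 0 := map_zero μ.1

theorem adOp_sum_left (μ : SkewAlg E) {ι : Type*} (s : Finset ι) (f : ι → E) :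
    adOp μ (∑ i ∈ s, f i) = ∑ i ∈ s, adOp μ (f i) := map_sum μ.1 f s

theorem adOp_ext {μ ν : SkewAlg E} (h : ∀ x y, adOp μ x y = adOp ν x y) : μ = ν :=
  Subtype.ext (LinearMap.ext₂ h)


/-- The infinitesimal action `A·μ = A μ(·, ·) - μ(A ·, ·) - μ(·, A ·)`. -/
def act (A : End ℂ E) (μ : SkewAlg E) : SkewAlg E :=
  ⟨LinearMap.mk₂ ℂ (fun x y => A (adOp μ x y) - adOp μ (A x) y - adOp μ x (A y))
    (fun x y z => by simp [adOp_add_left]; abel) (fun t x y => by simp [adOp_smul_left, smul_sub])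
    (fun x y z => by simp; abel) (fun t x y => by simp [smul_sub]),
   fun x => by simp [adOp_self, adOp_swap μ (A x) x]⟩

theorem act_apply (A : End ℂ E) (μ : SkewAlg E) (x y : E) :
    adOp (act A μ) x y = A (adOp μ x y) - adOp μ (A x) y - adOp μ x (A y) := rfl

theorem adOp_add_apply (μ ν : SkewAlg E) (x y : E) :
    adOp (μ + ν) x y = adOp μ x y + adOp ν x y := rfl

theorem adOp_sub_apply (μ ν : SkewAlg E) (x y : E) :
    adOp (μ - ν) x y = adOp μ x y - adOp ν x y := rfl

theorem adOp_neg_apply (μ : SkewAlg E) (x y : E) :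
    adOp (-μ) x y = -adOp μ x y := rfl

theorem adOp_smul_apply (t : ℂ) (μ : SkewAlg E) (x y : E) :
    adOp (t • μ) x y = t • adOp μ x y := rfl

theorem adOp_zero_apply (x y : E) : adOp (0 : SkewAlg E) x y = 0 := rfl

theorem act_eq_zero_iff {A : End ℂ E} {μ : SkewAlg E} : act A μ = 0 ↔ IsDerivation μ A := by
  constructor
  · intro h x y
    have := act_apply A μ x y
    rw [h, adOp_zero_apply, sub_sub] at this
    exact sub_eq_zero.1 this.symm
  · intro h
    refine adOp_ext fun x y => ?_
    rw [act_apply, adOp_zero_apply, h x y]; abel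

theorem act_add_right (A : End ℂ E) (μ ν : SkewAlg E) : act A (μ + ν) = act A μ + act A ν :=
  adOp_ext fun x y => by simp only [act_apply, adOp_add_apply, map_add]; abel

theorem act_add_left (A B : End ℂ E) (μ : SkewAlg E) : act (A + B) μ = act A μ + act B μ :=
  adOp_ext fun x y => by
    simp only [act_apply, adOp_add_apply, LinearMap.add_apply, adOp_add_left, map_add]; abel

theorem act_smul_id (c : ℂ) (μ : SkewAlg E) : act (c • LinearMap.id) μ = -(c • μ) :=
  adOp_ext fun x y => by
    simp only [act_apply, adOp_smul_apply, adOp_neg_apply, LinearMap.smul_apply, LinearMap.id_apply,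
      adOp_smul_left, map_smul]; abel

theorem act_zero_right (A : End ℂ E) : act A (0 : SkewAlg E) = 0 :=
  adOp_ext fun x y => by simp [act_apply, adOp_zero_apply]

theorem act_commutator (A B : End ℂ E) (μ : SkewAlg E) :
    act (A * B - B * A) μ = act A (act B μ) - act B (act A μ) :=
  adOp_ext fun x y => by
    simp only [act_apply, adOp_sub_apply, LinearMap.sub_apply, Module.End.mul_apply, adOp_sub_left,
      map_sub]
    abel

/-- The sum of the diagonal values of a sesquilinear map over an orthonormal basis does not depend
on the basis. -/
theorem sum_sesquilinear_eq {M : Type*} [AddCommGroup M] [Module ℂ M]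
    (S : E →ₗ[ℂ] E →ₗ⋆[ℂ] M) {ι κ : Type*} [Fintype ι] [Fintype κ]
    (b : OrthonormalBasis ι ℂ E) (f : OrthonormalBasis κ ℂ E) :
    ∑ i, S (b i) (b i) = ∑ j, S (f j) (f j) := by
  classical
  have h : ∀ i, S (b i) (b i) = ∑ j, ∑ k, (inner ℂ (f j) (b i) * inner ℂ (b i) (f k)) •
      S (f j) (f k) := fun i => by
    conv_lhs => rw [← f.sum_repr' (b i)]
    simp only [map_sum, map_smul, LinearMap.sum_apply, LinearMap.smul_apply, map_smulₛₗ,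
      inner_conj_symm, Finset.smul_sum, smul_smul]
    rw [Finset.sum_comm]
    refine Finset.sum_congr rfl fun j _ => Finset.sum_congr rfl fun k _ => ?_
    rw [mul_comm]
  simp only [h]
  rw [Finset.sum_comm]
  refine Finset.sum_congr rfl fun j _ => ?_
  rw [Finset.sum_comm]
  simp only [← Finset.sum_smul, b.sum_inner_mul_inner, f.inner_eq_ite, ite_smul, one_smul,
    zero_smul, Finset.sum_ite_eq, Finset.mem_univ, if_true]

variable [FiniteDimensional ℂ E]

theorem adjoint_inner_left' (T : E →ₗ[ℂ] E) (x y : E) :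
    inner ℂ (LinearMap.adjoint T x) y = inner ℂ x (T y) := LinearMap.adjoint_inner_left T y x

/-- The moment map in terms of an arbitrary orthonormal basis. -/
theorem inner_opR (μ : SkewAlg E) {ι : Type*} [Fintype ι] (b : OrthonormalBasis ι ℂ E) (x y : E) :
    inner ℂ x (opR μ y) =
      -4 * LinearMap.trace ℂ E (LinearMap.adjoint (adOp μ x) ∘ₗ adOp μ y) +
      2 * ∑ i, inner ℂ (LinearMap.adjoint (adOp μ (b i)) x)
        (LinearMap.adjoint (adOp μ (b i)) y) := by
  let S : E →ₗ[ℂ] E →ₗ⋆[ℂ] ℂ := LinearMap.mk₂'ₛₗ (RingHom.id ℂ) (starRingEnd ℂ)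
    (fun u v => inner ℂ (LinearMap.adjoint (adOp μ u) x) (LinearMap.adjoint (adOp μ v) y))
    (fun u v w => by simp [adOp_add_left])
    (fun t u w => by simp only [adOp_smul_left, map_smulₛₗ, LinearMap.smul_apply, inner_smul_left, RingHom.id_apply, Complex.conj_conj, smul_eq_mul])
    (fun u v w => by simp [adOp_add_left])
    (fun t u w => by simp only [adOp_smul_left, map_smulₛₗ, LinearMap.smul_apply, inner_smul_right, smul_eq_mul])
  have h := sum_sesquilinear_eq S b (stdOrthonormalBasis ℂ E)
  simp only [S, LinearMap.mk₂'ₛₗ_apply] at h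
  rw [h, LinearMap.trace_eq_sum_inner _ (stdOrthonormalBasis ℂ E)]
  simp only [opR, LinearMap.add_apply, LinearMap.smul_apply, LinearMap.sum_apply,
    LinearMap.comp_apply, inner_add_right, inner_smul_right, inner_sum,
    LinearMap.adjoint_inner_right]
  congr 2
  · refine Finset.sum_congr rfl fun i _ => ?_
    rw [adOp_swap μ x, adOp_swap μ y, inner_neg_neg]
  · exact Finset.sum_congr rfl fun i _ =>
      (LinearMap.adjoint_inner_left _ _ _).symm.trans (LinearMap.adjoint_inner_right _ _ _)

/-- The inner product on `V(E)`. -/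
noncomputable def innerAlg (μ ν : SkewAlg E) : ℂ :=
  ∑ i, ∑ j, inner ℂ (adOp μ (stdOrthonormalBasis ℂ E i) (stdOrthonormalBasis ℂ E j))
    (adOp ν (stdOrthonormalBasis ℂ E i) (stdOrthonormalBasis ℂ E j))

theorem innerAlg_self (μ : SkewAlg E) : innerAlg μ μ = (normSqAlg μ : ℂ) := by
  simp [innerAlg, normSqAlg, inner_self_eq_norm_sq_to_K]

theorem innerAlg_add_left (μ ν ρ : SkewAlg E) :
    innerAlg (μ + ν) ρ = innerAlg μ ρ + innerAlg ν ρ := by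
  simp [innerAlg, adOp_add_apply, Finset.sum_add_distrib]

theorem innerAlg_add_right (μ ν ρ : SkewAlg E) :
    innerAlg μ (ν + ρ) = innerAlg μ ν + innerAlg μ ρ := by
  simp [innerAlg, adOp_add_apply, Finset.sum_add_distrib]

theorem innerAlg_neg_smul_right (c : ℂ) (μ ν : SkewAlg E) :
    innerAlg μ (-(c • ν)) = -c * innerAlg μ ν := by
  simp [innerAlg, adOp_neg_apply, adOp_smul_apply, inner_smul_right, Finset.mul_sum]

theorem innerAlg_neg_smul_left (c : ℝ) (μ ν : SkewAlg E) :
    innerAlg (-((c : ℂ) • μ)) ν = -c * innerAlg μ ν := by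
  simp only [innerAlg, adOp_neg_apply, adOp_smul_apply, inner_neg_left, inner_smul_left,
    Complex.conj_ofReal, Finset.mul_sum, neg_mul]

theorem innerAlg_sub_right (μ ν ρ : SkewAlg E) :
    innerAlg μ (ν - ρ) = innerAlg μ ν - innerAlg μ ρ := by
  simp [innerAlg, adOp_sub_apply, Finset.sum_sub_distrib]

theorem innerAlg_zero_right (μ : SkewAlg E) : innerAlg μ 0 = 0 := by
  simp [innerAlg, adOp_zero_apply]

theorem normSqAlg_eq_zero {μ : SkewAlg E} (h : normSqAlg μ = 0) : μ = 0 := by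
  rw [normSqAlg, Finset.sum_eq_zero_iff_of_nonneg (fun i _ => by positivity)] at h
  apply Subtype.ext
  refine (stdOrthonormalBasis ℂ E).toBasis.ext fun i =>
    (stdOrthonormalBasis ℂ E).toBasis.ext fun j => ?_
  have h1 := h i (Finset.mem_univ i)
  rw [Finset.sum_eq_zero_iff_of_nonneg (fun i _ => by positivity)] at h1
  have h2 := h1 j (Finset.mem_univ j)
  simp only [OrthonormalBasis.coe_toBasis]
  exact norm_eq_zero.1 (pow_eq_zero_iff two_ne_zero |>.1 h2)

theorem normSqAlg_pos {μ : SkewAlg E} (h : μ ≠ 0) : 0 < normSqAlg μ :=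
  lt_of_le_of_ne (by rw [normSqAlg]; positivity) fun h0 => h (normSqAlg_eq_zero h0.symm)

/-- Both sides are tr (A f^* g), up to cyclic order. -/
theorem sum_inner_adjoint_comp {ι : Type*} [Fintype ι] (b : OrthonormalBasis ι ℂ E)
    (f g A : E →ₗ[ℂ] E) :
    ∑ i, inner ℂ (f (LinearMap.adjoint A (b i))) (g (b i)) = ∑ i, inner ℂ (f (b i)) (g (A (b i))) := by
  have h1 : LinearMap.trace ℂ E (A ∘ₗ (LinearMap.adjoint f ∘ₗ g))
      = ∑ i, inner ℂ (f (LinearMap.adjoint A (b i))) (g (b i)) := by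
    rw [LinearMap.trace_eq_sum_inner _ b]
    refine Finset.sum_congr rfl fun i _ => ?_
    simp only [LinearMap.comp_apply]
    rw [← adjoint_inner_left', LinearMap.adjoint_inner_right]
  rw [← h1, LinearMap.trace_comp_comm', LinearMap.trace_eq_sum_inner _ b]
  refine Finset.sum_congr rfl fun i _ => ?_
  simp only [LinearMap.comp_apply, LinearMap.adjoint_inner_right]

/-- The term with A outside the bracket moves by definition of the adjoint; in the other two A moves
between the arguments by a trace computation over the basis. -/
theorem innerAlg_act_adjoint (A : End ℂ E) (μ ν : SkewAlg E) :
    innerAlg (act (LinearMap.adjoint A) μ) ν = innerAlg μ (act A ν) := by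
  simp only [innerAlg, act_apply, inner_sub_left, inner_sub_right, Finset.sum_sub_distrib]
  congr 1
  · congr 1
    · simp only [adjoint_inner_left']
    · rw [Finset.sum_comm]
      conv_rhs => rw [Finset.sum_comm]
      refine Finset.sum_congr rfl fun j _ => ?_
      have := sum_inner_adjoint_comp (stdOrthonormalBasis ℂ E)
        (μ.1.flip (stdOrthonormalBasis ℂ E j)) (ν.1.flip (stdOrthonormalBasis ℂ E j)) A
      exact this
  · refine Finset.sum_congr rfl fun i _ => ?_
    exact sum_inner_adjoint_comp _ _ _ _

theorem trace_opR_mul (μ : SkewAlg E) (A : End ℂ E) :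
    LinearMap.trace ℂ E (opR μ * A) = 2 * innerAlg μ (act A μ) :=
  trace_opR_comp μ A

/-- As A·μ = 0, the commutator acts by [A, A^*]·μ = A·(A^*·μ), and the outer A passes to the other
side of the inner product as A^*. -/
theorem trace_opR_commutator_adjoint {μ : SkewAlg E} {A : End ℂ E} (hA : IsDerivation μ A) :
    LinearMap.trace ℂ E (opR μ * (A * LinearMap.adjoint A - LinearMap.adjoint A * A)) =
      2 * (normSqAlg (act (LinearMap.adjoint A) μ) : ℂ) := by
  rw [trace_opR_mul, act_commutator, act_eq_zero_iff.2 hA, act_zero_right,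
    innerAlg_sub_right, innerAlg_zero_right, sub_zero,
    ← innerAlg_act_adjoint, innerAlg_self]

/-- A derivation whose adjoint is a derivation commutes with the moment map. -/
theorem opR_comm_of_derivation {μ : SkewAlg E} {A : End ℂ E} (hA : IsDerivation μ A)
    (hA' : IsDerivation μ (LinearMap.adjoint A)) : opR μ * A = A * opR μ := by
  rw [← sub_eq_zero]
  apply eq_zero_of_trace_comp_adjoint
  -- tr ([R, A] B) = tr (R [A, B]) = 2⟨μ, A·(B·μ)⟩ = 2⟨A^*·μ, B·μ⟩ = 0.
  have h : ∀ B : End ℂ E, LinearMap.trace ℂ E ((opR μ * A - A * opR μ) * B) = 0 := fun B => by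
    have e : LinearMap.trace ℂ E ((opR μ * A - A * opR μ) * B)
        = LinearMap.trace ℂ E (opR μ * (A * B - B * A)) := by
      rw [sub_mul, mul_sub, map_sub, map_sub, mul_assoc A, LinearMap.trace_mul_comm ℂ A]
      simp only [mul_assoc]
    rw [e, trace_opR_mul, act_commutator, act_eq_zero_iff.2 hA, act_zero_right,
    innerAlg_sub_right, innerAlg_zero_right, sub_zero,
      ← innerAlg_act_adjoint, act_eq_zero_iff.2 hA']
    simp [innerAlg, adOp_zero_apply]
  exact h _

theorem trace_opR_comm_zero {μ : SkewAlg E} {c : ℂ} {D A B : End ℂ E}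
    (h : opR μ = c • LinearMap.id + D) (hDA : D * A = A * D) :
    LinearMap.trace ℂ E (opR μ * (A * B - B * A)) = 0 := by
  have hRA : opR μ * A = A * opR μ := by
    rw [h]; ext x; simpa using congrArg (fun f : End ℂ E => f x) hDA
  rw [mul_sub, map_sub, ← mul_assoc, ← mul_assoc, hRA, LinearMap.trace_mul_comm ℂ (opR μ * B),
    mul_assoc, sub_self]

/-- If `D` commutes with a derivation `A` of `μ`, where `R_μ = c I + D`, then the adjoint of `A` is
a derivation. -/
theorem isDerivation_adjoint {μ : SkewAlg E} {c : ℂ} {D A : End ℂ E}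
    (h : opR μ = c • LinearMap.id + D) (hA : IsDerivation μ A) (hDA : D * A = A * D) :
    IsDerivation μ (LinearMap.adjoint A) := by
  have h1 := trace_opR_commutator_adjoint hA
  -- The commutator trace is also 2‖A^*·μ‖², so its vanishing says exactly that A^* is a derivation.
  rw [trace_opR_comm_zero h hDA] at h1
  apply act_eq_zero_iff.1
  apply normSqAlg_eq_zero
  simpa using h1.symm

theorem act_opR {μ : SkewAlg E} {c : ℝ} {D : End ℂ E}
    (h : opR μ = (c : ℂ) • LinearMap.id + D) (hD : IsDerivation μ D) :
    act (opR μ) μ = -((c : ℂ) • μ) := by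
  rw [h, act_add_left, act_eq_zero_iff.2 hD, add_zero, act_smul_id]

theorem trace_opR_sq {μ : SkewAlg E} {c : ℝ} {D : End ℂ E}
    (h : opR μ = (c : ℂ) • LinearMap.id + D) (hD : IsDerivation μ D) :
    LinearMap.trace ℂ E (opR μ * opR μ) = -2 * c * normSqAlg μ := by
  rw [trace_opR_mul, act_opR h hD, innerAlg_neg_smul_right, innerAlg_self]
  ring

/-- tr R² = -2c‖μ‖² is nonnegative since R is hermitian, and it is nonzero because tr R = -2‖μ‖². -/
theorem scalar_neg {μ : SkewAlg E} {c : ℝ} {D : End ℂ E}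
    (h : opR μ = (c : ℂ) • LinearMap.id + D) (hD : IsDerivation μ D) (h0 : μ ≠ 0) : c < 0 := by
  have hN := normSqAlg_pos h0
  have h1 := trace_opR_sq h hD
  have h2 := trace_comp_adjoint (opR μ)
  rw [opR_adjoint] at h2
  set S : ℝ := ∑ i, ‖(opR μ) (stdOrthonormalBasis ℂ E i)‖ ^ 2
  have hS : 0 ≤ S := by positivity
  have h3 : S = -2 * c * normSqAlg μ := by
    have := h2.symm.trans h1
    exact_mod_cast this
  have h4 : S ≠ 0 := fun h5 => by
    have h6 : opR μ = 0 := by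
      apply eq_zero_of_trace_comp_adjoint
      rw [opR_adjoint]
      exact h2.trans (by rw [h5]; simp)
    have h7 := trace_opR_mul μ ((1 : ℂ) • LinearMap.id)
    rw [act_smul_id, innerAlg_neg_smul_right, innerAlg_self, h6, zero_mul, map_zero] at h7
    have : (normSqAlg μ : ℂ) = 0 := by linear_combination (-1 / 2) * h7.symm
    exact hN.ne' (by exact_mod_cast this)
  have h5 : 0 < S := lt_of_le_of_ne hS h4.symm
  nlinarith

theorem opR_add_smul (μ ν : SkewAlg E) (t : ℝ) :
    opR (μ + (t : ℂ) • ν) =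
      opR μ + (t : ℂ) • (opR (μ + ν) - opR μ - opR ν) + ((t : ℂ) ^ 2) • opR ν := by
  have h : ∀ s : ℂ, ∀ x, adOp (μ + s • ν) x = adOp μ x + s • adOp ν x := fun _ _ => rfl
  have h1 : ∀ x, adOp (μ + ν) x = adOp μ x + adOp ν x := fun _ => rfl
  simp only [opR, h, h1, map_add, map_smulₛₗ, Complex.conj_ofReal, LinearMap.add_comp,
    LinearMap.comp_add, LinearMap.smul_comp, LinearMap.comp_smul, Finset.sum_add_distrib,
    ← Finset.smul_sum]
  module

theorem normSqAlg_add_smul (μ ν : SkewAlg E) (t : ℝ) :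
    normSqAlg (μ + (t : ℂ) • ν) =
      normSqAlg μ + t * (normSqAlg (μ + ν) - normSqAlg μ - normSqAlg ν) + t ^ 2 * normSqAlg ν := by
  have h : ∀ x y : E, ‖x + (t : ℂ) • y‖ ^ 2 = ‖x‖ ^ 2 + t * (‖x + y‖ ^ 2 - ‖x‖ ^ 2 - ‖y‖ ^ 2)
      + t ^ 2 * ‖y‖ ^ 2 := fun x y => by
    rw [@norm_add_sq ℂ, @norm_add_sq ℂ _ _ _ _ x y, inner_smul_right, norm_smul]
    simp [mul_pow]
    ring
  simp only [normSqAlg, adOp_add_apply, adOp_smul_apply, h, Finset.sum_add_distrib,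
    Finset.sum_sub_distrib, ← Finset.mul_sum]

theorem funF_eq (μ : SkewAlg E) :
    funF μ = (LinearMap.trace ℂ E (opR μ * opR μ)).re / normSqAlg μ ^ 2 := by
  have : LinearMap.trace ℂ E (momentMap μ ∘ₗ momentMap μ)
      = ((normSqAlg μ ^ 2)⁻¹ : ℝ) * LinearMap.trace ℂ E (opR μ * opR μ) := by
    rw [momentMap, LinearMap.smul_comp, LinearMap.comp_smul, smul_smul, map_smul, smul_eq_mul]
    push_cast
    rw [pow_two, mul_inv]; rfl
  rw [funF, this, Complex.re_ofReal_mul, div_eq_inv_mul]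

/-- At 0 the numerator and the denominator have the same logarithmic derivative 2 N₁ / N₀; the
coefficients of higher order play no role. -/
theorem hasDerivAt_quotient_zero {N₀ : ℝ} (hN : N₀ ≠ 0) (c N₁ N₂ a₂ a₃ a₄ : ℝ) :
    HasDerivAt (fun t : ℝ => (-2 * c * N₀ + t * (-4 * c * N₁) + t ^ 2 * a₂ + t ^ 3 * a₃ + t ^ 4 * a₄)
      / (N₀ + t * N₁ + t ^ 2 * N₂) ^ 2) 0 0 := by
  have hid := hasDerivAt_id (0 : ℝ)
  have hnum : HasDerivAt (fun t : ℝ => -2 * c * N₀ + t * (-4 * c * N₁) + t ^ 2 * a₂ + t ^ 3 * a₃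
      + t ^ 4 * a₄) (-4 * c * N₁) 0 :=
    HasDerivAt.congr_deriv (((((hid.mul_const (-4 * c * N₁)).const_add (-2 * c * N₀)).add
      ((hid.pow 2).mul_const a₂)).add ((hid.pow 3).mul_const a₃)).add ((hid.pow 4).mul_const a₄))
      (by simp)
  have hden : HasDerivAt (fun t : ℝ => (N₀ + t * N₁ + t ^ 2 * N₂) ^ 2) (2 * N₀ * N₁) 0 :=
    HasDerivAt.congr_deriv
      ((((hid.mul_const N₁).const_add N₀).add ((hid.pow 2).mul_const N₂)).pow 2) (by simp)
  refine (hnum.div hden (by simp [hN])).congr_deriv ?_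
  have : -4 * c * N₁ * (N₀ + 0 * N₁ + 0 ^ 2 * N₂) ^ 2 -
      (-2 * c * N₀ + 0 * (-4 * c * N₁) + 0 ^ 2 * a₂ + 0 ^ 3 * a₃ + 0 ^ 4 * a₄) * (2 * N₀ * N₁) = 0 := by
    ring
  rw [this, zero_div]

/-- A bracket with `R_μ = c I + D`, `D` a derivation, is a critical point of `F`. -/
theorem isCriticalPoint_of_derivation {μ : SkewAlg E} {c : ℝ} {D : End ℂ E}
    (h : opR μ = (c : ℂ) • LinearMap.id + D) (hD : IsDerivation μ D) (h0 : μ ≠ 0) :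
    IsCriticalPoint μ := by
  refine ⟨h0, fun ν => ?_⟩
  have hN := normSqAlg_pos h0
  have hact := act_opR h hD
  set N₀ := normSqAlg μ with hN₀
  set N₂ := normSqAlg ν with hN₂
  set N₁ := normSqAlg (μ + ν) - N₀ - N₂ with hN₁
  set R₁ : End ℂ E := opR (μ + ν) - opR μ - opR ν with hR₁
  have hN1 : (N₁ : ℂ) = innerAlg μ ν + innerAlg ν μ := by
    rw [hN₁, hN₀, hN₂]; push_cast
    rw [← innerAlg_self, ← innerAlg_self, ← innerAlg_self, innerAlg_add_left, innerAlg_add_right,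
      innerAlg_add_right]
    ring
  -- Polarized moment map identity: the trace is 2⟨μ, R·ν⟩ + 2⟨ν, R·μ⟩, and R is hermitian with R·μ
  -- = -cμ.
  have hR01 : LinearMap.trace ℂ E (R₁ * opR μ) = -2 * c * N₁ := by
    rw [hR₁, sub_mul, sub_mul, map_sub, map_sub, trace_opR_mul, trace_opR_mul, trace_opR_mul,
      act_add_right, innerAlg_add_left, innerAlg_add_right, innerAlg_add_right, hact,
      ← innerAlg_act_adjoint (opR μ) μ ν, opR_adjoint, hact, innerAlg_neg_smul_right,
      innerAlg_neg_smul_right, innerAlg_neg_smul_left, hN1]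
    ring
  have hp : ∀ t : ℝ, (LinearMap.trace ℂ E (opR (μ + (t : ℂ) • ν) * opR (μ + (t : ℂ) • ν))).re
      = -2 * c * N₀ + t * (-4 * c * N₁) + t ^ 2 * ((LinearMap.trace ℂ E (R₁ * R₁)).re
        + 2 * (LinearMap.trace ℂ E (opR ν * opR μ)).re)
        + t ^ 3 * (2 * (LinearMap.trace ℂ E (opR ν * R₁)).re)
        + t ^ 4 * (LinearMap.trace ℂ E (opR ν * opR ν)).re := fun t => by
    have e : LinearMap.trace ℂ E (opR (μ + (t : ℂ) • ν) * opR (μ + (t : ℂ) • ν))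
        = ((-2 * c * N₀ : ℝ) : ℂ) + (t : ℝ) * ((-4 * c * N₁ : ℝ) : ℂ)
          + (t ^ 2 : ℝ) * (LinearMap.trace ℂ E (R₁ * R₁)
          + (2 : ℝ) * LinearMap.trace ℂ E (opR ν * opR μ))
          + (t ^ 3 : ℝ) * ((2 : ℝ) * LinearMap.trace ℂ E (opR ν * R₁))
          + (t ^ 4 : ℝ) * LinearMap.trace ℂ E (opR ν * opR ν) := by
      rw [opR_add_smul]
      simp only [add_mul, mul_add, smul_mul_assoc, mul_smul_comm, map_add, map_smul, smul_eq_mul]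
      rw [LinearMap.trace_mul_comm ℂ (opR μ) (opR (μ + ν) - opR μ - opR ν), hR01,
        LinearMap.trace_mul_comm ℂ (opR μ) (opR ν),
        LinearMap.trace_mul_comm ℂ (opR (μ + ν) - opR μ - opR ν) (opR ν), trace_opR_sq h hD]
      push_cast
      ring
    rw [e]
    simp only [Complex.add_re, Complex.re_ofReal_mul, Complex.ofReal_re]
  have hF : (fun t : ℝ => funF (μ + (t : ℂ) • ν)) = fun t : ℝ =>
      (-2 * c * N₀ + t * (-4 * c * N₁) + t ^ 2 * ((LinearMap.trace ℂ E (R₁ * R₁)).re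
        + 2 * (LinearMap.trace ℂ E (opR ν * opR μ)).re)
        + t ^ 3 * (2 * (LinearMap.trace ℂ E (opR ν * R₁)).re)
        + t ^ 4 * (LinearMap.trace ℂ E (opR ν * opR ν)).re) / (N₀ + t * N₁ + t ^ 2 * N₂) ^ 2 := by
    funext t
    rw [funF_eq, hp, normSqAlg_add_smul]
  rw [hF]
  exact hasDerivAt_quotient_zero hN.ne' c N₁ N₂ _ _ _

end Moment

/-! ### The moment map of a bracket split into a subalgebra and an orthogonal ideal. -/

section Splitting

variable {E : Type*} [NormedAddCommGroup E] [InnerProductSpace ℂ E]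

theorem adOp_comm_derivation {μ : SkewAlg E} {T : End ℂ E} (hT : IsDerivation μ T) (x : E) :
    adOp μ (T x) = T * adOp μ x - adOp μ x * T := by
  ext y
  simp [hT x y]

theorem isDerivation_adOp {μ : SkewAlg E} (hμ : IsLieBracket μ) (x : E) :
    IsDerivation μ (adOp μ x) := fun y z => hμ x y z

variable [FiniteDimensional ℂ E]

theorem adjoint_mem_of_forall_mem_orthogonal {g : Submodule ℂ E} {f : E →ₗ[ℂ] E}
    (hf : ∀ x ∈ gᗮ, f x ∈ gᗮ) {x : E} (hx : x ∈ g) : LinearMap.adjoint f x ∈ g := by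
  rw [← g.orthogonal_orthogonal, Submodule.mem_orthogonal]
  intro u hu
  rw [LinearMap.adjoint_inner_right]
  exact Submodule.inner_left_of_mem_orthogonal hx (hf u hu)

theorem adjoint_mem_orthogonal_of_forall_mem {g : Submodule ℂ E} {f : E →ₗ[ℂ] E}
    (hf : ∀ x ∈ g, f x ∈ g) {x : E} (hx : x ∈ gᗮ) : LinearMap.adjoint f x ∈ gᗮ := by
  rw [Submodule.mem_orthogonal]
  intro u hu
  rw [LinearMap.adjoint_inner_right]
  exact Submodule.inner_right_of_mem_orthogonal (hf u hu) hx

theorem adjoint_restrict {g : Submodule ℂ E} {f : E →ₗ[ℂ] E} (hf : ∀ x ∈ g, f x ∈ g)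
    (hf' : ∀ x ∈ g, LinearMap.adjoint f x ∈ g) :
    LinearMap.adjoint (f.restrict hf) = (LinearMap.adjoint f).restrict hf' := by
  symm
  rw [LinearMap.eq_adjoint_iff]
  intro x y
  exact LinearMap.adjoint_inner_left f (y : E) (x : E)

theorem sum_inner_adjoint_self {g : Submodule ℂ E} {f : E →ₗ[ℂ] E} (hf : ∀ x ∈ g, f x ∈ g)
    (hf' : ∀ x ∈ g, LinearMap.adjoint f x ∈ g) {ι : Type*} [Fintype ι]
    (a : OrthonormalBasis ι ℂ g) :
    ∑ i, inner ℂ (LinearMap.adjoint f (a i : E)) (LinearMap.adjoint f (a i : E))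
      = ∑ i, inner ℂ (f (a i : E)) (f (a i : E)) := by
  have h := sum_inner_adjoint_comp a (f.restrict hf) LinearMap.id (f.restrict hf)
  rw [adjoint_restrict hf hf'] at h
  refine Eq.trans (Finset.sum_congr rfl fun i _ => ?_) h
  exact LinearMap.adjoint_inner_right f (LinearMap.adjoint f (a i : E)) (a i : E)

theorem exists_orthonormalBasis_sum (g : Submodule ℂ E) {ι κ : Type*} [Fintype ι] [Fintype κ]
    (a : OrthonormalBasis ι ℂ g) (x : OrthonormalBasis κ ℂ gᗮ) :
    ∃ b : OrthonormalBasis (ι ⊕ κ) ℂ E,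
      (∀ i, b (Sum.inl i) = a i) ∧ ∀ j, b (Sum.inr j) = x j := by
  refine ⟨(a.prod x).map g.orthogonalDecomposition.symm, fun i => ?_, fun j => ?_⟩ <;> simp

/-- A Lie bracket `μ` on `g ⊕ gᗮ`, with a subalgebra `g` and an ideal `gᗮ` which is invariant
under `ad g`, such that the adjoints of the operators in `ad g` are derivations. -/
structure IsAdjointSplitting (μ : SkewAlg E) (g : Submodule ℂ E) : Prop where
  lie : IsLieBracket μ
  left_left : ∀ A ∈ g, ∀ B ∈ g, adOp μ A B ∈ g
  left_right : ∀ A ∈ g, ∀ X ∈ gᗮ, adOp μ A X ∈ gᗮ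
  right_right : ∀ X ∈ gᗮ, ∀ Y ∈ gᗮ, adOp μ X Y ∈ gᗮ
  adjoint : ∀ A ∈ g, IsDerivation μ (LinearMap.adjoint (adOp μ A))

namespace IsAdjointSplitting

variable {μ : SkewAlg E} {g : Submodule ℂ E} (h : IsAdjointSplitting μ g)

include h

theorem adjoint_left {A : E} (hA : A ∈ g) {B : E} (hB : B ∈ g) :
    LinearMap.adjoint (adOp μ A) B ∈ g :=
  adjoint_mem_of_forall_mem_orthogonal (h.left_right A hA) hB

theorem adjoint_right {A : E} (hA : A ∈ g) {X : E} (hX : X ∈ gᗮ) :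
    LinearMap.adjoint (adOp μ A) X ∈ gᗮ :=
  adjoint_mem_orthogonal_of_forall_mem (h.left_left A hA) hX

theorem right_mem {X : E} (hX : X ∈ gᗮ) (v : E) : adOp μ X v ∈ gᗮ := by
  obtain ⟨y, hy, z, hz, rfl⟩ := g.exists_add_mem_mem_orthogonal v
  rw [map_add, adOp_swap μ X y]
  exact add_mem (neg_mem (h.left_right y hy X hX)) (h.right_right X hX z hz)

theorem adjoint_adOp_right_left {X : E} (hX : X ∈ gᗮ) {A : E} (hA : A ∈ g) :
    LinearMap.adjoint (adOp μ X) A = 0 := by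
  refine ext_inner_right ℂ fun v => ?_
  rw [LinearMap.adjoint_inner_left, inner_zero_left]
  exact Submodule.inner_right_of_mem_orthogonal hA (h.right_mem hX v)

variable {ι : Type*} [Fintype ι] (a : OrthonormalBasis ι ℂ g)

theorem adOp_sum_adjoint :
    adOp μ (∑ i, LinearMap.adjoint (adOp μ (a i : E)) (a i : E)) =
      ∑ i, LinearMap.adjoint (adOp μ (a i : E)) * adOp μ (a i : E) -
        ∑ i, adOp μ (a i : E) * LinearMap.adjoint (adOp μ (a i : E)) := by
  rw [adOp_sum_left, ← Finset.sum_sub_distrib]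
  exact Finset.sum_congr rfl fun i _ => adOp_comm_derivation (h.adjoint _ (a i).2) _

/-- ‖Z‖² equals minus the trace of ad Z on g. Since the adjoints are derivations, ad Z is a sum of
commutators [(ad a_i)^*, ad a_i] of operators preserving g, so that trace is zero. -/
theorem sum_adjoint_eq_zero : ∑ i, LinearMap.adjoint (adOp μ (a i : E)) (a i : E) = 0 := by
  set Z : E := ∑ i, LinearMap.adjoint (adOp μ (a i : E)) (a i : E) with hZ
  have h1 : inner ℂ Z Z = -∑ j, inner ℂ (a j : E) (adOp μ Z (a j)) := by
    conv_lhs => rw [hZ]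
    rw [sum_inner, ← Finset.sum_neg_distrib]
    refine Finset.sum_congr rfl fun j _ => ?_
    rw [← hZ, LinearMap.adjoint_inner_left, adOp_swap, inner_neg_right]
  have h2 : ∑ j, inner ℂ (a j : E) (adOp μ Z (a j)) = 0 := by
    rw [hZ, h.adOp_sum_adjoint a]
    simp only [LinearMap.sub_apply, LinearMap.sum_apply, inner_sub_right, inner_sum,
      Finset.sum_sub_distrib, Module.End.mul_apply]
    rw [sub_eq_zero, Finset.sum_comm]
    conv_rhs => rw [Finset.sum_comm]
    refine Finset.sum_congr rfl fun i _ => ?_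
    have h3 := sum_inner_adjoint_self (h.left_left _ (a i).2)
      (fun x hx => h.adjoint_left (a i).2 hx) a
    refine Eq.trans ?_ (h3.symm.trans ?_)
    · exact Finset.sum_congr rfl fun j _ => LinearMap.adjoint_inner_right _ _ _
    · exact Finset.sum_congr rfl fun j _ => LinearMap.adjoint_inner_left _ _ _
  rw [h2, neg_zero] at h1
  exact inner_self_eq_zero.1 h1

theorem sum_adjoint_mul :
    ∑ i, LinearMap.adjoint (adOp μ (a i : E)) * adOp μ (a i : E) =
      ∑ i, adOp μ (a i : E) * LinearMap.adjoint (adOp μ (a i : E)) := by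
  have := h.adOp_sum_adjoint a
  rw [h.sum_adjoint_eq_zero a, adOp_zero_left] at this
  exact (sub_eq_zero.1 this.symm)

/-- This turns the part of R coming from g into brackets with the a_i, the form in which it can
cancel against the other terms. -/
theorem sum_inner_adjoint (x y : E) :
    ∑ i, inner ℂ (LinearMap.adjoint (adOp μ (a i : E)) x) (LinearMap.adjoint (adOp μ (a i : E)) y)
      = ∑ i, inner ℂ (adOp μ x (a i)) (adOp μ y (a i)) := by
  have h1 := congrArg (fun f : End ℂ E => inner ℂ x (f y)) (h.sum_adjoint_mul a)
  simp only [LinearMap.sum_apply, inner_sum, Module.End.mul_apply] at h1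
  refine Eq.trans (Finset.sum_congr rfl fun i _ => ?_) (h1.symm.trans
    (Finset.sum_congr rfl fun i _ => ?_))
  · exact LinearMap.adjoint_inner_left _ _ _
  · rw [adOp_swap μ x, adOp_swap μ y, inner_neg_neg]
    exact LinearMap.adjoint_inner_right _ _ _

/-- Basis vectors X of the ideal do not contribute to the second sum: ad X takes values in gᗮ, so
(ad X)^* vanishes on g. -/
theorem inner_opR_left_left {A : E} (hA : A ∈ g) (B : E) :
    inner ℂ A (opR μ B) =
      -4 * LinearMap.trace ℂ E (LinearMap.adjoint (adOp μ A) ∘ₗ adOp μ B) +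
      2 * ∑ i, inner ℂ (adOp μ A (a i)) (adOp μ B (a i)) := by
  obtain ⟨b, hb1, hb2⟩ := exists_orthonormalBasis_sum g a (stdOrthonormalBasis ℂ gᗮ)
  rw [inner_opR μ b, Fintype.sum_sum_type]
  simp only [hb1, hb2, h.sum_inner_adjoint a]
  rw [Finset.sum_eq_zero (s := Finset.univ (α := Fin _)), add_zero]
  intro j _
  rw [h.adjoint_adOp_right_left (Subtype.property _) hA, inner_zero_left]

theorem inner_opR_left_right {A Y : E} (hA : A ∈ g) (hY : Y ∈ gᗮ) :
    inner ℂ A (opR μ Y) =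
      -4 * LinearMap.trace ℂ E (LinearMap.adjoint (adOp μ A) ∘ₗ adOp μ Y) := by
  obtain ⟨b, hb1, hb2⟩ := exists_orthonormalBasis_sum g (stdOrthonormalBasis ℂ g)
    (stdOrthonormalBasis ℂ gᗮ)
  rw [inner_opR μ b, Fintype.sum_sum_type]
  simp only [hb1, hb2]
  rw [Finset.sum_eq_zero, Finset.sum_eq_zero, add_zero, mul_zero, add_zero]
  · intro j _
    rw [h.adjoint_adOp_right_left (Subtype.property _) hA, inner_zero_left]
  · intro i _
    exact Submodule.inner_right_of_mem_orthogonal (h.adjoint_left (Subtype.property _) hA)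
      (h.adjoint_right (Subtype.property _) hY)

/-- Put s = ∑ ⟨[Y, a_i], [Z, a_i]⟩. Compared with R of the ideal, the trace term gains s, the sum
over the basis of the ideal gains s, and the sum over the basis of g is s. The total excess -4s +
2(s + s) is zero. -/
theorem inner_opR_right_right {F : Type*} [NormedAddCommGroup F] [InnerProductSpace ℂ F]
    [FiniteDimensional ℂ F] {lam : SkewAlg F} (e : F ≃ₗᵢ[ℂ] gᗮ)
    (he : ∀ x y, adOp μ (e x : E) (e y : E) = (e (adOp lam x y) : E)) (y z : F) :
    inner ℂ (e y : E) (opR μ (e z : E)) = inner ℂ y (opR lam z) := by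
  let a := stdOrthonormalBasis ℂ g
  let f := stdOrthonormalBasis ℂ F
  obtain ⟨b, hb1, hb2⟩ := exists_orthonormalBasis_sum g a (f.map e)
  have hei : ∀ u v : F, inner ℂ (e u : E) (e v : E) = inner ℂ u v := fun u v =>
    e.inner_map_map u v
  have hb3 : ∀ j, b (Sum.inr j) = e (f j) := fun j => by rw [hb2]; simp
  have hy := (e y).2
  have hz := (e z).2
  set Y : E := ((e y : gᗮ) : E) with hY
  set Z : E := ((e z : gᗮ) : E) with hZ
  have h1 : LinearMap.trace ℂ E (LinearMap.adjoint (adOp μ Y) ∘ₗ adOp μ Z)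
      = ∑ i, inner ℂ (adOp μ Y (a i)) (adOp μ Z (a i)) +
        LinearMap.trace ℂ F (LinearMap.adjoint (adOp lam y) ∘ₗ adOp lam z) := by
    rw [LinearMap.trace_eq_sum_inner _ b, LinearMap.trace_eq_sum_inner _ f, Fintype.sum_sum_type]
    simp only [hb1, hb3, LinearMap.comp_apply, LinearMap.adjoint_inner_right, hY, hZ, he, hei]
  have h2 : ∑ j, inner ℂ (LinearMap.adjoint (adOp μ (e (f j) : E)) Y)
        (LinearMap.adjoint (adOp μ (e (f j) : E)) Z) =
      ∑ i, inner ℂ (adOp μ Y (a i)) (adOp μ Z (a i)) +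
      ∑ j, inner ℂ (LinearMap.adjoint (adOp lam (f j)) y)
        (LinearMap.adjoint (adOp lam (f j)) z) := by
    have h3 : ∀ j, inner ℂ (LinearMap.adjoint (adOp μ (e (f j) : E)) Y)
        (LinearMap.adjoint (adOp μ (e (f j) : E)) Z)
        = ∑ i, inner ℂ (LinearMap.adjoint (adOp μ (a i : E)) Y) (e (f j) : E) *
            inner ℂ (e (f j) : E) (LinearMap.adjoint (adOp μ (a i : E)) Z) +
          inner ℂ (LinearMap.adjoint (adOp lam (f j)) y)
            (LinearMap.adjoint (adOp lam (f j)) z) := fun j => by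
      rw [← b.sum_inner_mul_inner, ← f.sum_inner_mul_inner, Fintype.sum_sum_type]
      simp only [hb1, hb3, LinearMap.adjoint_inner_right, LinearMap.adjoint_inner_left]
      congr 1
      · refine Finset.sum_congr rfl fun i _ => ?_
        rw [adOp_swap μ (a i : E), inner_neg_right, inner_neg_left, neg_mul_neg]
      · simp only [he, hY, hZ, hei]
    simp only [h3]
    rw [Finset.sum_add_distrib, Finset.sum_comm]
    congr 1
    rw [← h.sum_inner_adjoint a]
    refine Finset.sum_congr rfl fun i _ => ?_
    rw [← b.sum_inner_mul_inner, Fintype.sum_sum_type]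
    symm
    rw [Finset.sum_eq_zero, zero_add]
    · simp only [hb3]
    · intro k _
      rw [hb1, Submodule.inner_left_of_mem_orthogonal (a k).2
        (h.adjoint_right (Subtype.property _) hy), zero_mul]
  rw [inner_opR μ b, inner_opR lam f, Fintype.sum_sum_type]
  simp only [hb1, hb3]
  rw [h1, h2, h.sum_inner_adjoint a]
  ring

end IsAdjointSplitting

end Splitting

/-! ### Reductivity of the subalgebra. -/

section Reductive

variable {E : Type*} [NormedAddCommGroup E] [InnerProductSpace ℂ E]

instance [FiniteDimensional ℂ E] (μ : LieBracket E) : FiniteDimensional ℂ (LieAlg μ) :=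
  inferInstanceAs (FiniteDimensional ℂ E)

theorem LieAlg.ad_pow_of (μ : LieBracket E) (x : E) (m : ℕ) (v : E) :
    ((LieAlgebra.ad ℂ (LieAlg μ) (LieAlg.of μ x)) ^ m) (LieAlg.of μ v)
      = LieAlg.of μ (((adOp μ.1 x : End ℂ E) ^ m) v) := by
  induction m with
  | zero => rfl
  | succ m ih =>
    rw [pow_succ', pow_succ', Module.End.mul_apply, Module.End.mul_apply, ih]
    rfl

variable [FiniteDimensional ℂ E]

/-- A subalgebra, all of whose inner derivations have an adjoint which is a derivation, is
reductive. -/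
theorem IsAdjointSplitting.isReductiveSubalgebra {μ : LieBracket E} {g : Submodule ℂ E}
    (h : IsAdjointSplitting μ.1 g) : IsReductiveSubalgebra μ g := by
  let s : LieSubalgebra ℂ (LieAlg μ) :=
    { g.map (LieAlg.of μ).toLinearMap with
      lie_mem' := by
        rintro _ _ ⟨x, hx, rfl⟩ ⟨y, hy, rfl⟩
        exact ⟨adOp μ.1 x y, h.left_left x hx y hy, rfl⟩ }
  refine ⟨s, rfl, hasCentralRadical_of_trace fun x hx => ?_⟩
  let φ : g ≃ₗ[ℂ] s := (LieAlg.of μ).submoduleMap g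
  obtain ⟨A, rfl⟩ := φ.surjective x
  have hφ : ∀ y : g, ((φ y : s) : LieAlg μ) = LieAlg.of μ (y : E) := fun _ => rfl
  have hlie : ∀ y z : g, ⁅φ y, φ z⁆ = φ ⟨adOp μ.1 y z, h.left_left y y.2 z z.2⟩ := fun _ _ => rfl
  have hf := h.left_left A A.2
  have hf' : ∀ x ∈ g, LinearMap.adjoint (adOp μ.1 A) x ∈ g := fun x hx => h.adjoint_left A.2 hx
  -- The test derivation is the restriction of (ad A)^* to g; it makes the trace the squared norm of
  -- ad A on g.
  have h1 := hx (φ.conj ((LinearMap.adjoint (adOp μ.1 A)).restrict hf')) (by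
    intro y z
    obtain ⟨y, rfl⟩ := φ.surjective y
    obtain ⟨z, rfl⟩ := φ.surjective z
    simp only [hlie, LinearEquiv.conj_apply_apply, LinearEquiv.symm_apply_apply, ← map_add]
    congr 1
    ext
    exact h.adjoint A A.2 y z)
  have h2 : LieAlgebra.ad ℂ s (φ A) = φ.conj ((adOp μ.1 A).restrict hf) := by
    ext1 y
    obtain ⟨y, rfl⟩ := φ.surjective y
    rw [LieAlgebra.ad_apply, hlie, LinearEquiv.conj_apply_apply, LinearEquiv.symm_apply_apply]
    rfl
  rw [h2, ← LinearEquiv.conj_comp, LinearMap.trace_conj', ← adjoint_restrict hf hf'] at h1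
  have h3 := eq_zero_of_trace_comp_adjoint h1
  rw [LieModule.mem_maxTrivSubmodule]
  intro y
  rw [← lie_skew, ← LieAlgebra.ad_apply ℂ, h2, h3]
  simp

end Reductive

/-! ### The grading by the eigenvalues of the derivation. -/

section Grading

variable {E : Type*} [NormedAddCommGroup E] [InnerProductSpace ℂ E]

/-- The sum of the eigenspaces of `T` for the integers `≥ t`. -/
def eigenFiltration (T : End ℂ E) (t : ℕ) : Submodule ℂ E :=
  ⨆ (m : ℕ) (_ : t ≤ m), End.eigenspace T (m : ℂ)

theorem eigenspace_le_eigenFiltration (T : End ℂ E) {t m : ℕ} (h : t ≤ m) :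
    End.eigenspace T (m : ℂ) ≤ eigenFiltration T t :=
  le_iSup₂_of_le m h le_rfl

theorem IsDerivation.smul {μ : SkewAlg E} {D : End ℂ E} (h : IsDerivation μ D) (a : ℂ) :
    IsDerivation μ (a • D : End ℂ E) := fun x y => by
  simp [h x y, adOp_smul_left]

theorem IsDerivation.adOp_mem_eigenspace {μ : SkewAlg E} {T : End ℂ E} (h : IsDerivation μ T)
    {s t : ℂ} {x y : E} (hx : x ∈ End.eigenspace T s) (hy : y ∈ End.eigenspace T t) :
    adOp μ x y ∈ End.eigenspace T (s + t) := by
  rw [End.mem_eigenspace_iff] at *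
  rw [h x y, hx, hy, adOp_smul_left, add_smul, map_smul, LinearMap.smul_apply]

theorem IsDerivation.adOp_mem_eigenFiltration {μ : SkewAlg E} {T : End ℂ E} (h : IsDerivation μ T)
    {s t : ℕ} {x y : E} (hx : x ∈ eigenFiltration T s) (hy : y ∈ eigenFiltration T t) :
    adOp μ x y ∈ eigenFiltration T (s + t) := by
  have key : Submodule.map₂ μ.1 (eigenFiltration T s) (eigenFiltration T t)
      ≤ eigenFiltration T (s + t) := by
    rw [eigenFiltration, eigenFiltration]
    simp only [Submodule.map₂_iSup_left, Submodule.map₂_iSup_right, iSup_le_iff]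
    intro m hm l hl
    refine Submodule.map₂_le.2 fun x hx y hy => ?_
    refine eigenspace_le_eigenFiltration T (add_le_add hl hm) ?_
    rw [Nat.cast_add]
    exact h.adOp_mem_eigenspace hx hy
  exact key (Submodule.apply_mem_map₂ _ hx hy)

theorem iSup_eq_top_of_sum_finrank [FiniteDimensional ℂ E] {ι : Type*} [Fintype ι]
    {V : ι → Submodule ℂ E} (hV : iSupIndep V) (h : ∑ i, finrank ℂ (V i) = finrank ℂ E) :
    ⨆ i, V i = ⊤ := by
  classical
  have h1 := hV.dfinsupp_lsum_injective
  have h2 : finrank ℂ (Π₀ i, V i) = finrank ℂ E := by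
    rw [← h]; exact Module.finrank_directSum ℂ (fun i => V i)
  rw [Submodule.iSup_eq_range_dfinsupp_lsum, LinearMap.range_eq_top]
  exact (LinearMap.injective_iff_surjective_of_finrank_eq_finrank h2).1 h1

variable [FiniteDimensional ℂ E]

namespace IsTypeData

variable {μ : SkewAlg E} {c a : ℝ} {D : E →ₗ[ℂ] E} {r : ℕ} {k d : Fin r → ℕ}
  (h : IsTypeData μ c a D k d)

include h

theorem adjoint_eq : LinearMap.adjoint D = D := by
  have h1 : D = opR μ - (c : ℂ) • LinearMap.id := by rw [h.opR_eq]; abel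
  rw [h1, map_sub, opR_adjoint, map_smulₛₗ, LinearMap.adjoint_id, Complex.conj_ofReal]

theorem isSymmetric : LinearMap.IsSymmetric ((a : ℂ) • D) := by
  intro x y
  rw [LinearMap.smul_apply, LinearMap.smul_apply, inner_smul_left, inner_smul_right,
    Complex.conj_ofReal, ← adjoint_inner_left', h.adjoint_eq]

theorem inner_eq_zero {s t : ℂ} (hst : s ≠ t) {x y : E}
    (hx : x ∈ End.eigenspace ((a : ℂ) • D) s) (hy : y ∈ End.eigenspace ((a : ℂ) • D) t) :
    inner ℂ x y = 0 :=
  h.isSymmetric.orthogonalFamily_eigenspaces hst ⟨x, hx⟩ ⟨y, hy⟩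

theorem iSup_eigenspace : ⨆ i, End.eigenspace ((a : ℂ) • D) (k i : ℂ) = ⊤ := by
  refine iSup_eq_top_of_sum_finrank
    ((End.eigenspaces_iSupIndep _).comp (f := fun i => (k i : ℂ)) fun i j hij => ?_) ?_
  · exact h.k_strictMono.injective (Nat.cast_injective (R := ℂ) hij)
  · simp only [h.finrank_eigenspace, h.sum_d]

theorem a_ne_zero : (a : ℂ) ≠ 0 := by exact_mod_cast h.a_pos.ne'

theorem eigenspace_zero {x : E} : x ∈ End.eigenspace ((a : ℂ) • D) 0 ↔ D x = 0 := by
  rw [End.mem_eigenspace_iff, LinearMap.smul_apply, zero_smul, smul_eq_zero_iff_right h.a_ne_zero]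

theorem eigenspace_eq_bot {s : ℂ} (hs : ∀ i, (k i : ℂ) ≠ s) :
    End.eigenspace ((a : ℂ) • D) s = ⊥ := by
  rw [eq_bot_iff]
  intro x hx
  have h1 : (⊤ : Submodule ℂ E) ≤ (ℂ ∙ x)ᗮ := by
    rw [← h.iSup_eigenspace, iSup_le_iff]
    intro i y hy
    exact Submodule.mem_orthogonal_singleton_iff_inner_right.2
      (h.inner_eq_zero (hs i).symm hx hy)
  exact inner_self_eq_zero.1
    (Submodule.mem_orthogonal_singleton_iff_inner_right.1 (h1 (Submodule.mem_top (x := x))))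

theorem eigenFiltration_zero : eigenFiltration ((a : ℂ) • D) 0 = ⊤ := by
  rw [eq_top_iff, ← h.iSup_eigenspace]
  exact iSup_le fun i => eigenspace_le_eigenFiltration _ (Nat.zero_le _)

theorem exists_eigenFiltration_eq_bot : ∃ t, eigenFiltration ((a : ℂ) • D) t = ⊥ := by
  -- This integer exceeds every eigenvalue.
  refine ⟨∑ i, k i + 1, ?_⟩
  rw [eigenFiltration, iSup_eq_bot]
  intro m
  rw [iSup_eq_bot]
  intro hm
  refine h.eigenspace_eq_bot fun i hi => ?_
  have h1 : k i = m := by exact_mod_cast hi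
  have h2 := Finset.single_le_sum (f := k) (fun _ _ => Nat.zero_le _) (Finset.mem_univ i)
  omega

theorem isDerivation_smul : IsDerivation μ ((a : ℂ) • D : End ℂ E) := h.isDerivation.smul _

theorem isNilpotent_adOp {x : E} (hx : x ∈ eigenFiltration ((a : ℂ) • D) 1) :
    IsNilpotent (adOp μ x : End ℂ E) := by
  obtain ⟨t, ht⟩ := h.exists_eigenFiltration_eq_bot
  refine ⟨t, LinearMap.ext fun v => ?_⟩
  have h1 : ∀ m : ℕ, ((adOp μ x : End ℂ E) ^ m) v ∈ eigenFiltration ((a : ℂ) • D) m := fun m => by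
    induction m with
    | zero => rw [h.eigenFiltration_zero]; trivial
    | succ m ih =>
      rw [pow_succ', Module.End.mul_apply, add_comm]
      exact h.isDerivation_smul.adOp_mem_eigenFiltration hx ih
  have h2 := h1 t
  rw [ht] at h2
  simpa using h2

/-- If `y` has positive degree, then `ad A` is nilpotent if `ad (A + y)`
is nilpotent. -/
theorem isNilpotent_adOp_of_add {A y : E}
    (hy : y ∈ eigenFiltration ((a : ℂ) • D) 1)
    (hAy : IsNilpotent (adOp μ (A + y) : End ℂ E)) : IsNilpotent (adOp μ A : End ℂ E) := by
  obtain ⟨t, ht⟩ := h.exists_eigenFiltration_eq_bot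
  obtain ⟨M, hM⟩ := hAy
  have hA0 : A ∈ eigenFiltration ((a : ℂ) • D) 0 := by rw [h.eigenFiltration_zero]; trivial
  have hAy0 : A + y ∈ eigenFiltration ((a : ℂ) • D) 0 := by rw [h.eigenFiltration_zero]; trivial
  have mem : ∀ {u w : E} {s t : ℕ}, u ∈ eigenFiltration ((a : ℂ) • D) s →
      w ∈ eigenFiltration ((a : ℂ) • D) t → adOp μ u w ∈ eigenFiltration ((a : ℂ) • D) (s + t) :=
    h.isDerivation_smul.adOp_mem_eigenFiltration
  -- Powers of ad (A + y) and of ad A agree modulo the next step of the filtration, because ad y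
  -- raises degrees.
  have h1 : ∀ (m s : ℕ) (v : E), v ∈ eigenFiltration ((a : ℂ) • D) s →
      ((adOp μ A : End ℂ E) ^ m) v ∈ eigenFiltration ((a : ℂ) • D) s ∧
      ((adOp μ (A + y) : End ℂ E) ^ m) v - ((adOp μ A : End ℂ E) ^ m) v
        ∈ eigenFiltration ((a : ℂ) • D) (s + 1) := fun m s v hv => by
    induction m with
    | zero => simpa using hv
    | succ m ih =>
      rw [pow_succ', pow_succ', Module.End.mul_apply, Module.End.mul_apply]
      refine ⟨by simpa using mem hA0 ih.1, ?_⟩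
      have e : adOp μ (A + y) (((adOp μ (A + y) : End ℂ E) ^ m) v)
            - adOp μ A (((adOp μ A : End ℂ E) ^ m) v)
          = adOp μ (A + y) (((adOp μ (A + y) : End ℂ E) ^ m) v - ((adOp μ A : End ℂ E) ^ m) v)
            + adOp μ y (((adOp μ A : End ℂ E) ^ m) v) := by
        rw [map_sub, adOp_add_left, LinearMap.add_apply, LinearMap.add_apply]; abel
      rw [e]
      refine add_mem (by simpa using mem hAy0 ih.2) ?_
      rw [add_comm s 1]
      exact mem hy ih.1
  -- As ad (A + y)^M = 0, the operator (ad A)^M raises the filtration, which terminates.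
  have h2 : ∀ (s : ℕ) (v : E), (((adOp μ A : End ℂ E) ^ M) ^ s) v
      ∈ eigenFiltration ((a : ℂ) • D) s := fun s v => by
    induction s with
    | zero => rw [h.eigenFiltration_zero]; trivial
    | succ s ih =>
      rw [pow_succ', Module.End.mul_apply]
      have h3 := (h1 M s _ ih).2
      rw [hM, LinearMap.zero_apply, zero_sub] at h3
      exact neg_mem_iff.1 h3
  refine ⟨M * t, LinearMap.ext fun v => ?_⟩
  have h3 := h2 t v
  rw [ht, ← pow_mul] at h3
  simpa using h3

theorem commute_adOp {A : E} (hA : D A = 0) : D * adOp μ A = (adOp μ A * D : End ℂ E) := by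
  have := adOp_comm_derivation h.isDerivation A
  rw [hA, adOp_zero_left] at this
  exact sub_eq_zero.1 this.symm

theorem isDerivation_adjoint_adOp (hμ : IsLieBracket μ) {A : E} (hA : D A = 0) :
    IsDerivation μ (LinearMap.adjoint (adOp μ A)) :=
  isDerivation_adjoint h.opR_eq (isDerivation_adOp hμ A) (h.commute_adOp hA)

/-- The center of `μ` has no elements of degree zero. -/
theorem eq_zero_of_adOp_eq_zero (h0 : μ ≠ 0) {A : E} (hA : D A = 0) (hA' : adOp μ A = 0) :
    A = 0 := by
  have hc := scalar_neg h.opR_eq h.isDerivation h0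
  have h1 := inner_opR μ (stdOrthonormalBasis ℂ E) A A
  rw [hA', LinearMap.comp_zero, map_zero, mul_zero, zero_add, h.opR_eq, LinearMap.add_apply, hA,
    add_zero, LinearMap.smul_apply, LinearMap.id_apply, inner_smul_right] at h1
  simp only [inner_self_eq_norm_sq_to_K] at h1
  -- For ad A = 0 only the nonnegative half of R survives, while R A = cA with c < 0.
  have h2 : c * ‖A‖ ^ 2 = 2 * ∑ i,
      ‖LinearMap.adjoint (adOp μ (stdOrthonormalBasis ℂ E i)) A‖ ^ 2 := by
    apply Complex.ofReal_injective
    push_cast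
    exact h1
  have h3 : 0 ≤ c * ‖A‖ ^ 2 := by rw [h2]; positivity
  have h4 : ‖A‖ ^ 2 = 0 := le_antisymm (by nlinarith [sq_nonneg ‖A‖]) (sq_nonneg _)
  exact norm_eq_zero.1 (pow_eq_zero_iff two_ne_zero |>.1 h4)

end IsTypeData

namespace IsTypeData

variable {μ : SkewAlg E} {c a : ℝ} {D : E →ₗ[ℂ] E} {r : ℕ} {k d : Fin (r + 1) → ℕ}
  (h : IsTypeData μ c a D k d) (hk : k 0 = 0)

include h

theorem positive_le_orthogonal :
    ⨆ i : Fin r, End.eigenspace ((a : ℂ) • D) (k i.succ : ℂ)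
      ≤ (End.eigenspace ((a : ℂ) • D) (k 0 : ℂ))ᗮ := by
  refine iSup_le fun i x hx => ?_
  rw [Submodule.mem_orthogonal]
  intro u hu
  refine h.inner_eq_zero (fun h1 => ?_) hu hx
  have h2 : k 0 = k i.succ := by exact_mod_cast h1
  exact absurd (h.k_strictMono.injective h2) (Fin.succ_ne_zero i).symm

theorem positive_eq_orthogonal :
    ⨆ i : Fin r, End.eigenspace ((a : ℂ) • D) (k i.succ : ℂ)
      = (End.eigenspace ((a : ℂ) • D) (k 0 : ℂ))ᗮ := by
  refine le_antisymm h.positive_le_orthogonal fun x hx => ?_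
  have h1 : x ∈ End.eigenspace ((a : ℂ) • D) (k 0 : ℂ) ⊔
      ⨆ i : Fin r, End.eigenspace ((a : ℂ) • D) (k i.succ : ℂ) := by
    have h3 : ⨆ i, End.eigenspace ((a : ℂ) • D) (k i : ℂ)
        ≤ End.eigenspace ((a : ℂ) • D) (k 0 : ℂ) ⊔
          ⨆ i : Fin r, End.eigenspace ((a : ℂ) • D) (k i.succ : ℂ) := by
      refine iSup_le fun i => ?_
      refine Fin.cases le_sup_left (fun i => ?_) i
      exact le_sup_of_le_right (le_iSup (fun i : Fin r =>
        End.eigenspace ((a : ℂ) • D) (k i.succ : ℂ)) i)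
    rw [h.iSup_eigenspace] at h3
    exact h3 trivial
  obtain ⟨u, hu, v, hv, rfl⟩ := Submodule.mem_sup.1 h1
  have h2 : u ∈ (End.eigenspace ((a : ℂ) • D) (k 0 : ℂ))ᗮ := by
    simpa using sub_mem hx (h.positive_le_orthogonal hv)
  have h3 : u = 0 := inner_self_eq_zero.1 (Submodule.inner_right_of_mem_orthogonal hu h2)
  rw [h3, zero_add]
  exact hv

theorem mem_eigenspace_first (hk : k 0 = 0) {x : E} :
    x ∈ End.eigenspace ((a : ℂ) • D) (k 0 : ℂ) ↔ D x = 0 := by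
  rw [hk, Nat.cast_zero, h.eigenspace_zero]

theorem eigenFiltration_one (hk : k 0 = 0) : eigenFiltration ((a : ℂ) • D) 1
    = (End.eigenspace ((a : ℂ) • D) (k 0 : ℂ))ᗮ := by
  refine le_antisymm (iSup₂_le fun m hm x hx => ?_) ?_
  · rw [Submodule.mem_orthogonal]
    intro u hu
    refine h.inner_eq_zero (fun h1 => ?_) hu hx
    have h2 : k 0 = m := by exact_mod_cast h1
    omega
  · rw [← h.positive_eq_orthogonal]
    refine iSup_le fun i => eigenspace_le_eigenFiltration _ ?_
    have := h.k_strictMono (Fin.succ_pos i)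
    omega

theorem isAdjointSplitting (hμ : IsLieBracket μ) (hk : k 0 = 0) :
    IsAdjointSplitting μ (End.eigenspace ((a : ℂ) • D) (k 0 : ℂ)) where
  lie := hμ
  left_left A hA B hB := by
    have := h.isDerivation_smul.adOp_mem_eigenspace hA hB
    simpa [hk] using this
  left_right A hA X hX := by
    rw [← h.eigenFiltration_one hk] at hX ⊢
    have hA0 : A ∈ eigenFiltration ((a : ℂ) • D) 0 := by rw [h.eigenFiltration_zero]; trivial
    simpa using h.isDerivation_smul.adOp_mem_eigenFiltration hA0 hX
  right_right X hX Y hY := by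
    rw [← h.eigenFiltration_one hk] at hX
    have hY0 : Y ∈ eigenFiltration ((a : ℂ) • D) 0 := by rw [h.eigenFiltration_zero]; trivial
    rw [← h.eigenFiltration_one hk]
    simpa using h.isDerivation_smul.adOp_mem_eigenFiltration hX hY0
  adjoint A hA := h.isDerivation_adjoint_adOp hμ ((h.mem_eigenspace_first hk).1 hA)

/-- An element `A` of degree zero, such that `ad A` is nilpotent and commutes with the subalgebra
of all the elements of degree zero, vanishes. -/
theorem eq_zero_of_isNilpotent (hμ : IsLieBracket μ) (hk : k 0 = 0) (h0 : μ ≠ 0) {A : E}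
    (hA : A ∈ End.eigenspace ((a : ℂ) • D) (k 0 : ℂ))
    (hcomm : ∀ B ∈ End.eigenspace ((a : ℂ) • D) (k 0 : ℂ), adOp μ B A = 0)
    (hnil : IsNilpotent (adOp μ A : End ℂ E)) : A = 0 := by
  have hs := h.isAdjointSplitting hμ hk
  have hDA := (h.mem_eigenspace_first hk).1 hA
  refine h.eq_zero_of_adOp_eq_zero h0 hDA ?_
  set T : End ℂ E := LinearMap.adjoint (adOp μ A) with hT
  -- ‖T A‖² = ⟨A, [A, T A]⟩, and T A lies in the degree-zero subalgebra, which commutes with A.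
  have hTA : T A = 0 := by
    have h1 : inner ℂ (T A) (T A) = 0 := by
      conv_lhs => arg 2; rw [hT]
      rw [LinearMap.adjoint_inner_left, adOp_swap, hcomm _ (hs.adjoint_left hA hA), neg_zero,
        inner_zero_right]
    exact inner_self_eq_zero.1 h1
  have h2 := adOp_comm_derivation (hs.adjoint A hA) A
  rw [← hT, hTA, adOp_zero_left] at h2
  -- [T, ad A] = ad (T A) = 0, so ad A is normal; a normal nilpotent operator is zero.
  have h3 : Commute (adOp μ A : End ℂ E) T := (sub_eq_zero.1 h2.symm).symm
  exact eq_zero_of_trace_comp_adjoint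
    (LinearMap.trace_eq_zero_of_isNilpotent (h3.isNilpotent_mul_right hnil))

end IsTypeData

end Grading

/-! ### The nilradical is the part of positive degree. -/

section Nilradical

theorem LieIdeal.coe_ad_pow {K L : Type*} [CommRing K] [LieRing L] [LieAlgebra K L]
    {J : LieIdeal K L} (x : J) (m : ℕ) (y : J) :
    (((LieAlgebra.ad K J x) ^ m) y : L) = ((LieAlgebra.ad K L x) ^ m) (y : L) := by
  induction m with
  | zero => rfl
  | succ m ih =>
    rw [pow_succ', pow_succ', Module.End.mul_apply, Module.End.mul_apply, ← ih]
    rfl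

theorem ad_nilpotent_of_mem_nilpotent_ideal {K L : Type*} [Field K] [LieRing L] [LieAlgebra K L]
    [FiniteDimensional K L] {J : LieIdeal K L} (hJ : LieRing.IsNilpotent J) {x : L} (hx : x ∈ J) :
    IsNilpotent (LieAlgebra.ad K L x) := by
  obtain ⟨m, hm⟩ := (LieAlgebra.isNilpotent_iff_forall (R := K)).1 hJ ⟨x, hx⟩
  -- The additional factor ad x brings v into J, where the m-th power vanishes.
  refine ⟨m + 1, LinearMap.ext fun v => ?_⟩
  rw [pow_succ, Module.End.mul_apply]
  have h2 := LieIdeal.coe_ad_pow (K := K) (⟨x, hx⟩ : J) m ⟨⁅x, v⁆, lie_mem_left K L J x v hx⟩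
  rw [hm] at h2
  exact h2.symm

variable {E : Type*} [NormedAddCommGroup E] [InnerProductSpace ℂ E] [FiniteDimensional ℂ E]
  {μ : LieBracket E} {c a : ℝ} {D : E →ₗ[ℂ] E} {r : ℕ} {k d : Fin (r + 1) → ℕ}

/-- The positive part is nilpotent by Engel's theorem. For maximality, the degree-zero part A of an
element of a nilpotent ideal J must vanish by `eq_zero_of_isNilpotent`. -/
theorem IsTypeData.isNilradical (h : IsTypeData μ.1 c a D k d) (hk : k 0 = 0) (h0 : μ.1 ≠ 0) :
    IsNilradical μ (⨆ i : Fin r, End.eigenspace ((a : ℂ) • D) (k i.succ : ℂ)) := by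
  have hs := h.isAdjointSplitting μ.2 hk
  rw [h.positive_eq_orthogonal]
  set g := End.eigenspace ((a : ℂ) • D) (k 0 : ℂ) with hg
  let I : LieIdeal ℂ (LieAlg μ) :=
    { gᗮ.map (LieAlg.of μ).toLinearMap with
      lie_mem := by
        rintro v _ ⟨x, hx, rfl⟩
        refine ⟨adOp μ.1 ((LieAlg.of μ).symm v) x, ?_, rfl⟩
        have := hs.right_mem hx ((LieAlg.of μ).symm v)
        rw [adOp_swap]
        exact neg_mem this }
  have hI : LieRing.IsNilpotent I := by
    refine (LieAlgebra.isNilpotent_iff_forall (R := ℂ)).2 ?_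
    rintro ⟨_, x, hx, rfl⟩
    rw [SetLike.mem_coe, ← h.eigenFiltration_one hk] at hx
    obtain ⟨m, hm⟩ := h.isNilpotent_adOp hx
    refine ⟨m, LinearMap.ext fun y => Subtype.ext ?_⟩
    rw [LieIdeal.coe_ad_pow]
    refine (LieAlg.ad_pow_of μ x m ((LieAlg.of μ).symm (y : LieAlg μ))).trans ?_
    rw [hm]
    rfl
  refine ⟨I, rfl, hI, fun J hJ => ?_⟩
  have hJ' : LieRing.IsNilpotent J := hJ
  intro x hx
  obtain ⟨A, hA, y, hy, hAy⟩ := g.exists_add_mem_mem_orthogonal ((LieAlg.of μ).symm x)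
  have hx' : x = LieAlg.of μ (A + y) := by rw [← hAy]; rfl
  have hyI : LieAlg.of μ y ∈ I := ⟨y, hy, rfl⟩
  suffices hA0 : A = 0 by
    rw [hx', hA0, zero_add]
    exact hyI
  have hAN : LieAlg.of μ A ∈ J + I := by
    have : LieAlg.of μ A = x + -LieAlg.of μ y := by rw [hx', map_add]; abel
    rw [this]
    exact (LieSubmodule.mem_sup _ _ _).2 ⟨x, hx, _, neg_mem hyI, rfl⟩
  refine h.eq_zero_of_isNilpotent μ.2 hk h0 hA (fun B hB => ?_) ?_
  · obtain ⟨s, hs1, hs2⟩ := hs.isReductiveSubalgebra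
    have hsmem : ∀ B ∈ g, LieAlg.of μ B ∈ s := fun B hB => by
      rw [← LieSubalgebra.mem_toSubmodule, hs1]
      exact ⟨B, hB, rfl⟩
    have hsolv : LieAlgebra.IsSolvable (J + I : LieIdeal ℂ (LieAlg μ)) := inferInstance
    -- A solvable ideal of the reductive subalgebra s that contains A; it lies in the radical, hence
    -- in the center of s.
    let N : LieIdeal ℂ s := (J + I).comap s.incl
    have hN : LieAlgebra.IsSolvable N := by
      let f : N →ₗ⁅ℂ⁆ (J + I : LieIdeal ℂ (LieAlg μ)) :=
        { toFun := fun z => ⟨((z : s) : LieAlg μ), z.2⟩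
          map_add' := fun _ _ => rfl
          map_smul' := fun _ _ => rfl
          map_lie' := rfl }
      refine Function.Injective.lieAlgebra_isSolvable (f := f) fun u v huv => ?_
      exact Subtype.ext (Subtype.ext (congrArg
        (fun w : (J + I : LieIdeal ℂ (LieAlg μ)) => (w : LieAlg μ)) huv))
    have hle := (LieAlgebra.LieIdeal.solvable_iff_le_radical ℂ s N).1 hN
    rw [hs2.radical_eq_center] at hle
    have hc := hle (show (⟨LieAlg.of μ A, hsmem A hA⟩ : s) ∈ N from hAN)
    have := (LieModule.mem_maxTrivSubmodule ℂ s s _).1 hc ⟨LieAlg.of μ B, hsmem B hB⟩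
    exact congrArg (fun w : s => (LieAlg.of μ).symm (w : LieAlg μ)) this
  · rw [← h.eigenFiltration_one hk] at hy
    refine h.isNilpotent_adOp_of_add hy ?_
    obtain ⟨m, hm⟩ := ad_nilpotent_of_mem_nilpotent_ideal (K := ℂ) hJ' hx
    refine ⟨m, LinearMap.ext fun v => ?_⟩
    have h1 := LieAlg.ad_pow_of μ (A + y) m v
    rw [← hx', hm] at h1
    exact h1.symm

end Nilradical

/-! ### Type and moment map of the restriction to the nilradical. -/

section Restriction

variable {E : Type*} [NormedAddCommGroup E] [InnerProductSpace ℂ E]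

theorem IsDerivation.restrictAlg {μ : SkewAlg E} {D : E →ₗ[ℂ] E} (hD : IsDerivation μ D)
    {n : Submodule ℂ E} (hn : ∀ x ∈ n, ∀ y ∈ n, adOp μ x y ∈ n) (hDn : ∀ x ∈ n, D x ∈ n) :
    IsDerivation (restrictAlg μ n hn) (D.restrict hDn) :=
  fun x y => Subtype.ext (hD x y)

variable [FiniteDimensional ℂ E] {μ : SkewAlg E} {c a : ℝ} {D : E →ₗ[ℂ] E} {r : ℕ} {k d : Fin (r + 1) → ℕ}

namespace IsTypeData

variable (h : IsTypeData μ c a D k d)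

include h

theorem map_mem_of_eq {n : Submodule ℂ E}
    (hn : n = ⨆ i : Fin r, End.eigenspace ((a : ℂ) • D) (k i.succ : ℂ)) :
    ∀ x ∈ n, D x ∈ n := by
  intro x hx
  have h1 : n ≤ n.comap D := by
    conv_lhs => rw [hn]
    refine iSup_le fun i x hx => ?_
    have h2 : D x = ((a : ℂ)⁻¹ * k i.succ) • x := by
      rw [mul_smul, ← End.mem_eigenspace_iff.1 hx, LinearMap.smul_apply, smul_smul,
        inv_mul_cancel₀ h.a_ne_zero, one_smul]
    rw [Submodule.mem_comap, h2, hn]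
    exact Submodule.smul_mem _ _ (le_iSup
      (fun i : Fin r => End.eigenspace ((a : ℂ) • D) (k i.succ : ℂ)) i hx)
  exact h1 hx

theorem finrank_positive {n : Submodule ℂ E}
    (hn : n = ⨆ i : Fin r, End.eigenspace ((a : ℂ) • D) (k i.succ : ℂ)) :
    finrank ℂ n + d 0 = finrank ℂ E := by
  rw [hn, h.positive_eq_orthogonal, ← h.finrank_eigenspace 0, add_comm]
  exact Submodule.finrank_add_finrank_orthogonal _

theorem opR_restrictAlg (hμ : IsLieBracket μ) (hk : k 0 = 0) {n : Submodule ℂ E}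
    (hn : n = ⨆ i : Fin r, End.eigenspace ((a : ℂ) • D) (k i.succ : ℂ))
    (hnn : ∀ x ∈ n, ∀ y ∈ n, adOp μ x y ∈ n) :
    opR (restrictAlg μ n hnn) = (c : ℂ) • LinearMap.id + D.restrict (h.map_mem_of_eq hn) := by
  have hs := h.isAdjointSplitting hμ hk
  have hng := hn.trans h.positive_eq_orthogonal
  refine LinearMap.ext fun z => ext_inner_left ℂ fun y => ?_
  have h1 := hs.inner_opR_right_right (lam := restrictAlg μ n hnn)
    (LinearIsometryEquiv.ofEq n _ hng) (fun _ _ => rfl) y z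
  rw [← h1, h.opR_eq]
  rfl

theorem isTypeData_restrictAlg (hμ : IsLieBracket μ) (hk : k 0 = 0) {n : Submodule ℂ E}
    (hn : n = ⨆ i : Fin r, End.eigenspace ((a : ℂ) • D) (k i.succ : ℂ))
    (hnn : ∀ x ∈ n, ∀ y ∈ n, adOp μ x y ∈ n) :
    IsTypeData (restrictAlg μ n hnn) c a (D.restrict (h.map_mem_of_eq hn))
      (fun i : Fin r => k i.succ) (fun i : Fin r => d i.succ) where
  opR_eq := h.opR_restrictAlg hμ hk hn hnn
  isDerivation := h.isDerivation.restrictAlg hnn _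
  a_pos := h.a_pos
  k_strictMono := h.k_strictMono.comp (Fin.strictMono_succ)
  k_coprime hD := by
    have h1 : D ≠ 0 := by
      rintro rfl
      exact hD (LinearMap.ext fun x => Subtype.ext rfl)
    rw [← Nat.dvd_one, ← h.k_coprime h1]
    refine Finset.dvd_gcd fun i _ => ?_
    refine Fin.cases ?_ (fun i => ?_) i
    · rw [hk]; exact dvd_zero _
    · exact Finset.gcd_dvd (Finset.mem_univ i)
  d_pos i := h.d_pos _
  finrank_eigenspace i := by
    have hle : End.eigenspace ((a : ℂ) • D) (k i.succ : ℂ) ≤ n := by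
      rw [hn]
      exact le_iSup (fun i : Fin r => End.eigenspace ((a : ℂ) • D) (k i.succ : ℂ)) i
    rw [← h.finrank_eigenspace i.succ,
      ← (Submodule.comapSubtypeEquivOfLe hle).finrank_eq]
    have e : End.eigenspace ((a : ℂ) • D.restrict (h.map_mem_of_eq hn)) (k i.succ : ℂ)
        = (End.eigenspace ((a : ℂ) • D) (k i.succ : ℂ)).comap n.subtype := by
      ext x
      rw [Submodule.mem_comap, End.mem_eigenspace_iff, End.mem_eigenspace_iff, ← Subtype.coe_inj]
      rfl
    rw [e]
  sum_d := by
    have h1 := h.finrank_positive hn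
    have h2 := h.sum_d
    rw [Fin.sum_univ_succ] at h2
    omega

/-- Here 0 = cI + D on n, so every positive k_i equals -ac; there is at most one, and coprimality
makes it 1. -/
theorem eq_one_of_restrictAlg_eq_zero (hμ : IsLieBracket μ) (hk : k 0 = 0) {n : Submodule ℂ E}
    (hn : n = ⨆ i : Fin r, End.eigenspace ((a : ℂ) • D) (k i.succ : ℂ))
    (hnn : ∀ x ∈ n, ∀ y ∈ n, adOp μ x y ∈ n) (h0 : restrictAlg μ n hnn = 0) :
    r ≤ 1 ∧ ∀ i : Fin r, k i.succ = 1 := by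
  have hR := h.opR_restrictAlg hμ hk hn hnn
  have hR0 : opR (restrictAlg μ n hnn) = 0 := by
    have h1 : ∀ x, adOp (0 : SkewAlg n) x = 0 := fun _ => rfl
    rw [h0]
    simp [opR, h1]
  rw [hR0] at hR
  have key : ∀ i : Fin r, D ≠ 0 ∧ ((k i.succ : ℝ) = -(a * c)) := fun i => by
    have h1 : End.eigenspace ((a : ℂ) • D) (k i.succ : ℂ) ≠ ⊥ := fun h2 => by
      have h3 := h.finrank_eigenspace i.succ
      rw [h2, finrank_bot] at h3
      exact (h.d_pos i.succ).ne h3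
    obtain ⟨v, hv, hv0⟩ := Submodule.exists_mem_ne_zero_of_ne_bot h1
    have hvn : v ∈ n := by
      rw [hn]
      exact le_iSup (fun i : Fin r => End.eigenspace ((a : ℂ) • D) (k i.succ : ℂ)) i hv
    have h2 : (0 : E) = (c : ℂ) • v + D v :=
      congrArg (fun w : n => (w : E)) (LinearMap.congr_fun hR ⟨v, hvn⟩)
    have h3 : D v = -((c : ℂ) • v) := (neg_eq_of_add_eq_zero_right h2.symm).symm
    have h4 := End.mem_eigenspace_iff.1 hv
    have hpos : 0 < k i.succ := by
      have := h.k_strictMono (Fin.succ_pos i)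
      omega
    refine ⟨?_, ?_⟩
    · rintro rfl
      rw [smul_zero, LinearMap.zero_apply] at h4
      rcases smul_eq_zero.1 h4.symm with h5 | h5
      · exact hpos.ne' (by exact_mod_cast h5)
      · exact hv0 h5
    · rw [LinearMap.smul_apply, h3, smul_neg, smul_smul, ← neg_smul] at h4
      have h5 := smul_left_injective ℂ hv0 h4
      have h6 : ((k i.succ : ℝ) : ℂ) = ((-(a * c) : ℝ) : ℂ) := by
        push_cast; exact h5.symm
      exact Complex.ofReal_injective h6
  have heq : ∀ i j : Fin r, k i.succ = k j.succ := fun i j => by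
    exact_mod_cast (key i).2.trans (key j).2.symm
  refine ⟨?_, fun i => ?_⟩
  · by_contra hr
    have h1 := heq ⟨0, by omega⟩ ⟨1, by omega⟩
    have h2 := Fin.succ_injective _ (h.k_strictMono.injective h1)
    simp at h2
  · rw [← Nat.dvd_one, ← h.k_coprime (key i).1]
    refine Finset.dvd_gcd fun j _ => ?_
    refine Fin.cases ?_ (fun j => ?_) j
    · rw [hk]; exact dvd_zero _
    · rw [heq i j]

end IsTypeData

/-- A nilpotent critical point has a positive type. -/
theorem IsTypeData.pos_of_isNilpotent {μ : LieBracket E} {c a : ℝ} {D : E →ₗ[ℂ] E} {r : ℕ}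
    {k d : Fin r → ℕ} (h : IsTypeData μ.1 c a D k d) (h0 : μ.1 ≠ 0)
    (hnil : LieRing.IsNilpotent (LieAlg μ)) (i : Fin r) : 0 < k i := by
  obtain _ | r := r
  · exact i.elim0
  -- With k_0 = 0 the nilradical would have codimension d_0 > 0, but the whole algebra is nilpotent.
  have hk : k 0 ≠ 0 := fun hk => by
    obtain ⟨I, hI1, hI2⟩ := h.isNilradical hk h0
    have hT : (⊤ : LieIdeal ℂ (LieAlg μ)) ≤ I :=
      hI2.2 (LieIdeal.topEquiv.nilpotent_iff_equiv_nilpotent.2 hnil)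
    have h1 : (⨆ i : Fin r, End.eigenspace ((a : ℂ) • D) (k i.succ : ℂ)) = ⊤ := by
      rw [eq_top_iff]
      intro x _
      have h2 : LieAlg.of μ x ∈ I.toSubmodule := hT (LieSubmodule.mem_top _)
      rw [hI1] at h2
      obtain ⟨y, hy, hyx⟩ := h2
      exact (LieAlg.of μ).injective hyx ▸ hy
    have h2 := h.finrank_positive rfl
    rw [h1, finrank_top] at h2
    have := h.d_pos 0
    omega
  exact lt_of_lt_of_le (Nat.pos_of_ne_zero hk) (h.k_strictMono.monotone (Fin.zero_le i))

end Restriction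

/-! ### Reductive subalgebras of gl(F) and their inner product. -/

section ReductiveSubalgebra

variable {F : Type*} [NormedAddCommGroup F] [InnerProductSpace ℂ F]

theorem trace_lie_mul (A B C : End ℂ F) :
    LinearMap.trace ℂ F (⁅A, B⁆ * C) = LinearMap.trace ℂ F (B * ⁅C, A⁆) := by
  rw [Ring.lie_def, Ring.lie_def, sub_mul, mul_sub, map_sub, map_sub, mul_assoc A,
    LinearMap.trace_mul_comm ℂ A, mul_assoc, mul_assoc]

/-- The trace form of a Lie subalgebra of `gl(F)`. -/
noncomputable def mulTraceForm (r : LieSubalgebra ℂ (End ℂ F)) : LinearMap.BilinForm ℂ r :=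
  LinearMap.mk₂ ℂ (fun A B : r => LinearMap.trace ℂ F ((A : End ℂ F) * (B : End ℂ F)))
    (fun A B C => by simp [add_mul]) (fun t A B => by simp)
    (fun A B C => by simp [mul_add]) (fun t A B => by simp)

theorem mulTraceForm_apply (r : LieSubalgebra ℂ (End ℂ F)) (A B : r) :
    mulTraceForm r A B = LinearMap.trace ℂ F ((A : End ℂ F) * (B : End ℂ F)) := rfl

theorem mulTraceForm_isRefl (r : LieSubalgebra ℂ (End ℂ F)) : (mulTraceForm r).IsRefl :=
  fun A B h => by
    rw [mulTraceForm_apply] at h ⊢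
    rw [LinearMap.trace_mul_comm, h]

variable {r : LieSubalgebra ℂ (End ℂ F)}

theorem ad_lie_eq (A B : r) : LieAlgebra.ad ℂ r ⁅A, B⁆ =
    LieAlgebra.ad ℂ r A ∘ₗ LieAlgebra.ad ℂ r B - LieAlgebra.ad ℂ r B ∘ₗ LieAlgebra.ad ℂ r A := by
  ext C; simp

variable [FiniteDimensional ℂ F]

theorem adjoint_lie (A B : End ℂ F) :
    LinearMap.adjoint ⁅A, B⁆ = (⁅LinearMap.adjoint B, LinearMap.adjoint A⁆ : End ℂ F) := by
  rw [Ring.lie_def, Ring.lie_def, map_sub, adjoint_mul, adjoint_mul]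

theorem adjoint_commute_of_mem_center
    (hz : ∀ A : r, A ∈ LieAlgebra.center ℂ r →
      Commute (A : End ℂ F) (LinearMap.adjoint (A : F →ₗ[ℂ] F)))
    {C : r} (hC : C ∈ LieAlgebra.center ℂ r) (B : r) :
    (⁅LinearMap.adjoint (C : End ℂ F), (B : End ℂ F)⁆ : End ℂ F) = 0 := by
  have h1 := (LieModule.mem_maxTrivSubmodule ℂ r r C).1 hC B
  have h2 : (⁅(B : End ℂ F), (C : End ℂ F)⁆ : End ℂ F) = 0 :=
    congrArg (fun w : r => (w : End ℂ F)) h1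
  rw [Ring.lie_def, sub_eq_zero] at h2 ⊢
  exact adjoint_mul_comm_of_normal (hz C hC) h2.symm

/-- Let a reductive subalgebra of `gl(F)` have a self-adjoint derived algebra and a center that
consists of normal operators. Then the adjoints of the operators `ad A` are of the form `ad S`. -/
theorem exists_lie_adjoint_eq [hr : LieAlgebra.HasCentralRadical ℂ r]
    (hs : ∀ A : r, A ∈ LieAlgebra.derivedSeries ℂ r 1 →
      LinearMap.adjoint (A : F →ₗ[ℂ] F) ∈ r)
    (hz : ∀ A : r, A ∈ LieAlgebra.center ℂ r →
      Commute (A : End ℂ F) (LinearMap.adjoint (A : F →ₗ[ℂ] F))) (A : r) :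
    ∃ S : r, ∀ B : r, (⁅LinearMap.adjoint (A : End ℂ F), (B : End ℂ F)⁆ : End ℂ F)
      = ⁅(S : End ℂ F), (B : End ℂ F)⁆ := by
  set s := LieAlgebra.derivedSeries ℂ r 1 with hs_def
  have hsl : ∀ B C : r, ⁅B, C⁆ ∈ s := fun B C => by
    rw [hs_def, LieAlgebra.derivedSeries_def, LieAlgebra.derivedSeriesOfIdeal_succ]
    exact LieSubmodule.lie_mem_lie (LieSubmodule.mem_top B) (LieSubmodule.mem_top C)
  have hspan : s.toSubmodule = Submodule.span ℂ {m | ∃ B C : r, ⁅B, C⁆ = m} := by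
    rw [hs_def, LieAlgebra.derivedSeries_def, LieAlgebra.derivedSeriesOfIdeal_succ,
      LieSubmodule.lieIdeal_oper_eq_linear_span']
    simp
  -- The orthogonal of s = [r, r] for the trace form tr (AB). It turns out to be a central
  -- complement of s.
  let t : LieIdeal ℂ r :=
    { (mulTraceForm r).orthogonal s.toSubmodule with
      lie_mem := by
        intro B C hC S hS
        have h1 := hC ⁅S, B⁆ (lie_mem_left ℂ r s S B hS)
        change LinearMap.trace ℂ F _ = 0 at h1
        change LinearMap.trace ℂ F _ = 0
        rw [LinearMap.trace_mul_comm]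
        exact (trace_lie_mul _ _ _).trans ((LinearMap.trace_mul_comm ℂ _ _).trans h1) }
  have ht : ∀ {C : r}, C ∈ t → ∀ S ∈ s,
      LinearMap.trace ℂ F ((C : End ℂ F) * (S : End ℂ F)) = 0 := fun {C} hC S hS => by
    rw [LinearMap.trace_mul_comm]
    exact hC S hS
  -- The bracket [C, C'] lies in t and its adjoint [C'^*, C^*] lies in s, as s is self-adjoint; so
  -- tr ([C, C'] [C, C']^*) = 0.
  have hab : ∀ C ∈ t ⊓ s, ∀ C' ∈ t ⊓ s, ⁅C, C'⁆ = 0 := fun C hC C' hC' => by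
    refine Subtype.ext (eq_zero_of_trace_comp_adjoint ?_)
    have h1 : LinearMap.adjoint ((⁅C, C'⁆ : r) : End ℂ F)
        = ((⁅(⟨_, hs C' hC'.2⟩ : r), (⟨_, hs C hC.2⟩ : r)⁆ : r) : End ℂ F) := adjoint_lie _ _
    rw [h1]
    exact ht (lie_mem_left ℂ r t C C' hC.1) _ (hsl _ _)
  have hcen : t ⊓ s ≤ LieAlgebra.center ℂ r := by
    have : IsLieAbelian (t ⊓ s : LieIdeal ℂ r) :=
      ⟨fun x y => Subtype.ext (hab x x.2 y y.2)⟩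
    rw [← hr.radical_eq_center]
    exact (LieAlgebra.LieIdeal.solvable_iff_le_radical ℂ r _).1 inferInstance
  -- C is central and normal, so by Fuglede C^* commutes with r, and B ↦ tr (B C^*) vanishes on
  -- commutators, in particular at C.
  have hbot : ∀ C ∈ t ⊓ s, C = 0 := fun C hC => by
    refine Subtype.ext (eq_zero_of_trace_comp_adjoint ?_)
    have h1 : s.toSubmodule ≤ LinearMap.ker (LinearMap.trace ℂ F ∘ₗ
        LinearMap.mulRight ℂ (LinearMap.adjoint (C : End ℂ F) : End ℂ F) ∘ₗ
        r.toSubmodule.subtype) := by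
      rw [hspan, Submodule.span_le]
      rintro _ ⟨B, B', rfl⟩
      change LinearMap.trace ℂ F (⁅(B : End ℂ F), (B' : End ℂ F)⁆ * _) = 0
      rw [trace_lie_mul, adjoint_commute_of_mem_center hz (hcen hC), mul_zero, map_zero]
    exact h1 hC.2
  have htc : t ≤ LieAlgebra.center ℂ r := fun C hC => by
    rw [LieModule.mem_maxTrivSubmodule]
    exact fun B => hbot _ ⟨lie_mem_right ℂ r t B C hC, hsl _ _⟩
  have hcompl := ((mulTraceForm r).isCompl_orthogonal_iff_disjoint (W := s.toSubmodule)
    (mulTraceForm_isRefl r)).2 (by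
      rw [Submodule.disjoint_def]
      exact fun C h1 h2 => hbot C ⟨h2, h1⟩)
  obtain ⟨S, hS, z, hzt, rfl⟩ := Submodule.mem_sup.1
    (hcompl.codisjoint.eq_top.symm ▸ Submodule.mem_top (x := A))
  -- In A = S + z with z central, the witness is S^*: the operator z^* commutes with r, so only S^*
  -- contributes to [A^*, B].
  refine ⟨⟨_, hs S hS⟩, fun B => ?_⟩
  have h1 := adjoint_commute_of_mem_center hz (htc (show z ∈ t from hzt)) B
  change ⁅LinearMap.adjoint ((S : End ℂ F) + (z : End ℂ F)), _⁆ = _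
  rw [map_add, add_lie, h1, add_zero]

theorem traceAdjoint_sub (T U : r →ₗ[ℂ] r) :
    traceAdjoint r (T - U) = traceAdjoint r T - traceAdjoint r U := by
  let : NormedAddCommGroup r := (traceCore r).toNormedAddCommGroup
  let : InnerProductSpace ℂ r := InnerProductSpace.ofCore (traceCore r).toCore
  exact map_sub LinearMap.adjoint T U

theorem traceAdjoint_comp (T U : r →ₗ[ℂ] r) :
    traceAdjoint r (T ∘ₗ U) = traceAdjoint r U ∘ₗ traceAdjoint r T := by
  let : NormedAddCommGroup r := (traceCore r).toNormedAddCommGroup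
  let : InnerProductSpace ℂ r := InnerProductSpace.ofCore (traceCore r).toCore
  exact LinearMap.adjoint_comp T U

theorem traceAdjoint_traceAdjoint (T : r →ₗ[ℂ] r) : traceAdjoint r (traceAdjoint r T) = T := by
  let : NormedAddCommGroup r := (traceCore r).toNormedAddCommGroup
  let : InnerProductSpace ℂ r := InnerProductSpace.ofCore (traceCore r).toCore
  exact LinearMap.adjoint_adjoint T

theorem eq_traceAdjoint {T U : r →ₗ[ℂ] r}
    (h : ∀ A B : r, LinearMap.trace ℂ F ((B : F →ₗ[ℂ] F) ∘ₗ LinearMap.adjoint (U A : F →ₗ[ℂ] F)) =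
      LinearMap.trace ℂ F ((T B : F →ₗ[ℂ] F) ∘ₗ LinearMap.adjoint (A : F →ₗ[ℂ] F))) :
    U = traceAdjoint r T := by
  let : NormedAddCommGroup r := (traceCore r).toNormedAddCommGroup
  let : InnerProductSpace ℂ r := InnerProductSpace.ofCore (traceCore r).toCore
  exact (LinearMap.eq_adjoint_iff U T).2 h

theorem trace_traceAdjoint (T : r →ₗ[ℂ] r) :
    LinearMap.trace ℂ r (traceAdjoint r T) = (starRingEnd ℂ) (LinearMap.trace ℂ r T) := by
  let : NormedAddCommGroup r := (traceCore r).toNormedAddCommGroup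
  let : InnerProductSpace ℂ r := InnerProductSpace.ofCore (traceCore r).toCore
  exact trace_adjoint T

theorem exists_trace_comp_traceAdjoint (T : r →ₗ[ℂ] r) :
    ∃ x : ℝ, 0 ≤ x ∧ LinearMap.trace ℂ r (T ∘ₗ traceAdjoint r T) = x := by
  let : NormedAddCommGroup r := (traceCore r).toNormedAddCommGroup
  let : InnerProductSpace ℂ r := InnerProductSpace.ofCore (traceCore r).toCore
  exact ⟨_, by positivity, trace_comp_adjoint T⟩

theorem trace_lie_comp_adjoint {A S : r}
    (h : ∀ B : r, (⁅LinearMap.adjoint (A : End ℂ F), (B : End ℂ F)⁆ : End ℂ F)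
      = ⁅(S : End ℂ F), (B : End ℂ F)⁆) (B C : r) :
    LinearMap.trace ℂ F ((⁅A, C⁆ : r) ∘ₗ LinearMap.adjoint (B : F →ₗ[ℂ] F)) =
      LinearMap.trace ℂ F
        ((C : F →ₗ[ℂ] F) ∘ₗ LinearMap.adjoint ((⁅S, B⁆ : r) : F →ₗ[ℂ] F)) := by
  have h1 : ((⁅S, B⁆ : r) : End ℂ F) = ⁅LinearMap.adjoint (A : End ℂ F), (B : End ℂ F)⁆ :=
    (h B).symm
  rw [h1, adjoint_lie, LinearMap.adjoint_adjoint]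
  exact trace_lie_mul _ _ _

theorem traceAdjoint_ad {A S : r}
    (h : ∀ B : r, (⁅LinearMap.adjoint (A : End ℂ F), (B : End ℂ F)⁆ : End ℂ F)
      = ⁅(S : End ℂ F), (B : End ℂ F)⁆) :
    traceAdjoint r (LieAlgebra.ad ℂ r A) = LieAlgebra.ad ℂ r S := by
  symm
  apply eq_traceAdjoint
  intro B C
  rw [LieAlgebra.ad_apply, LieAlgebra.ad_apply, trace_lie_comp_adjoint h]

/-- Thus ad A has the same adjoint ad S for the new inner product on r as for the trace inner
product. -/
theorem reductiveForm_lie {A S : r}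
    (h : ∀ B : r, (⁅LinearMap.adjoint (A : End ℂ F), (B : End ℂ F)⁆ : End ℂ F)
      = ⁅(S : End ℂ F), (B : End ℂ F)⁆) (c : ℝ) (B C : r) :
    reductiveForm c r ⁅A, C⁆ B = reductiveForm c r C ⁅S, B⁆ := by
  have h1 : LinearMap.trace ℂ r (LieAlgebra.ad ℂ r ⁅A, C⁆ ∘ₗ traceAdjoint r (LieAlgebra.ad ℂ r B))
      = LinearMap.trace ℂ r
        (LieAlgebra.ad ℂ r C ∘ₗ traceAdjoint r (LieAlgebra.ad ℂ r ⁅S, B⁆)) := by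
    rw [ad_lie_eq, ad_lie_eq, traceAdjoint_sub, traceAdjoint_comp, traceAdjoint_comp,
      ← traceAdjoint_ad h, traceAdjoint_traceAdjoint, LinearMap.sub_comp, LinearMap.comp_sub,
      map_sub, map_sub, LinearMap.comp_assoc, LinearMap.trace_comp_comm']
    rfl
  rw [reductiveForm, reductiveForm, h1, trace_lie_comp_adjoint h]

theorem reductiveForm_conj (c : ℝ) (A B : r) :
    (starRingEnd ℂ) (reductiveForm c r A B) = reductiveForm c r B A := by
  have h1 : (starRingEnd ℂ) (LinearMap.trace ℂ r
      (LieAlgebra.ad ℂ r A ∘ₗ traceAdjoint r (LieAlgebra.ad ℂ r B))) =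
      LinearMap.trace ℂ r (LieAlgebra.ad ℂ r B ∘ₗ traceAdjoint r (LieAlgebra.ad ℂ r A)) := by
    rw [← trace_traceAdjoint, traceAdjoint_comp, traceAdjoint_traceAdjoint]
  have h2 : (starRingEnd ℂ) (LinearMap.trace ℂ F
      ((A : F →ₗ[ℂ] F) ∘ₗ LinearMap.adjoint (B : F →ₗ[ℂ] F))) =
      LinearMap.trace ℂ F ((B : F →ₗ[ℂ] F) ∘ₗ LinearMap.adjoint (A : F →ₗ[ℂ] F)) := by
    rw [← trace_adjoint, LinearMap.adjoint_comp, LinearMap.adjoint_adjoint]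
  simp only [reductiveForm, map_mul, map_add, map_neg, map_div₀, Complex.conj_ofReal, h1, h2,
    map_one, Complex.conj_ofNat]

theorem reductiveForm_add_left (c : ℝ) (A B C : r) :
    reductiveForm c r (A + B) C = reductiveForm c r A C + reductiveForm c r B C := by
  have h1 : ((A + B : r) : F →ₗ[ℂ] F) = (A : F →ₗ[ℂ] F) + (B : F →ₗ[ℂ] F) := rfl
  simp only [reductiveForm, map_add, h1, LinearMap.add_comp]
  ring

theorem reductiveForm_smul_left (c : ℝ) (t : ℂ) (A B : r) :
    reductiveForm c r (t • A) B = t * reductiveForm c r A B := by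
  have h1 : ((t • A : r) : F →ₗ[ℂ] F) = t • (A : F →ₗ[ℂ] F) := rfl
  simp only [reductiveForm, map_smul, h1, LinearMap.smul_comp, smul_eq_mul]
  ring

theorem exists_reductiveForm_self {c : ℝ} (hc : c < 0) (A : r) :
    ∃ x : ℝ, 0 ≤ x ∧ reductiveForm c r A A = x ∧ (x = 0 → A = 0) := by
  obtain ⟨y, hy, h1⟩ := exists_trace_comp_traceAdjoint (LieAlgebra.ad ℂ r A)
  have h2 := trace_comp_adjoint (A : F →ₗ[ℂ] F)
  have hw : 0 ≤ ∑ i, ‖(A : F →ₗ[ℂ] F) (stdOrthonormalBasis ℂ F i)‖ ^ 2 := by positivity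
  generalize ∑ i, ‖(A : F →ₗ[ℂ] F) (stdOrthonormalBasis ℂ F i)‖ ^ 2 = w at h2 hw
  have hc' : 0 < -(4 / c) := by
    rw [neg_pos]; exact div_neg_of_pos_of_neg (by norm_num) hc
  refine ⟨-(4 / c) * (1 / 2 * y + w), by positivity, ?_, fun h3 => ?_⟩
  · rw [reductiveForm, h1, h2]; push_cast; rfl
  · have h4 : w = 0 := by
      rcases mul_eq_zero.1 h3 with h5 | h5
      · exact absurd h5 hc'.ne'
      · linarith
    refine Subtype.ext (eq_zero_of_trace_comp_adjoint ?_)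
    exact h2.trans (by rw [h4]; simp)

/-- The inner product on `r ⊕ F`. -/
@[reducible] noncomputable def semidirectCore {c : ℝ} (hc : c < 0)
    (r : LieSubalgebra ℂ (End ℂ F)) : InnerProductSpace.Core ℂ (r × F) where
  inner x y := reductiveForm c r y.1 x.1 + inner ℂ x.2 y.2
  conj_inner_symm x y := by
    rw [map_add, reductiveForm_conj, inner_conj_symm]
  re_inner_nonneg x := by
    obtain ⟨y, hy, h1, -⟩ := exists_reductiveForm_self hc x.1
    rw [h1, map_add]
    exact add_nonneg (by simpa using hy) inner_self_nonneg
  add_left x y z := by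
    rw [← reductiveForm_conj, Prod.fst_add, Prod.snd_add, reductiveForm_add_left, map_add,
      reductiveForm_conj, reductiveForm_conj, inner_add_left]
    ring
  smul_left x y t := by
    rw [← reductiveForm_conj, Prod.smul_fst, Prod.smul_snd, reductiveForm_smul_left, map_mul,
      reductiveForm_conj, inner_smul_left]
    ring
  definite x hx := by
    obtain ⟨y, hy, h1, h2⟩ := exists_reductiveForm_self hc x.1
    have h3 : y + ‖x.2‖ ^ 2 = 0 := by
      rw [h1, inner_self_eq_norm_sq_to_K] at hx
      apply Complex.ofReal_injective
      push_cast
      exact hx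
    have h4 := sq_nonneg ‖x.2‖
    refine Prod.ext (h2 (by linarith)) ?_
    exact norm_eq_zero.1 (pow_eq_zero_iff two_ne_zero |>.1 (by linarith))

end ReductiveSubalgebra

/-! ### The moment map of the semidirect product. -/

section Semidirect

variable {F : Type*} [NormedAddCommGroup F] [InnerProductSpace ℂ F]
  {r : LieSubalgebra ℂ (End ℂ F)} {lam : SkewAlg F}

theorem semidirect_apply (x y : r × F) :
    adOp (semidirect r lam) x y =
      (⁅x.1, y.1⁆, (x.1 : End ℂ F) y.2 - (y.1 : End ℂ F) x.2 + adOp lam x.2 y.2) := rfl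

theorem coe_lie_apply (A B : r) (X : F) :
    ((⁅A, B⁆ : r) : End ℂ F) X = (A : End ℂ F) ((B : End ℂ F) X) - (B : End ℂ F) ((A : End ℂ F) X) :=
  rfl

theorem isLieBracket_semidirect (hl : IsLieBracket lam)
    (hd : ∀ A : r, IsDerivation lam (A : F →ₗ[ℂ] F)) : IsLieBracket (semidirect r lam) := by
  rintro ⟨A, X⟩ ⟨B, Y⟩ ⟨C, Z⟩
  simp only [semidirect_apply]
  refine Prod.ext (leibniz_lie A B C) ?_
  simp only [Prod.snd_add, coe_lie_apply, map_add, map_sub, adOp_add_left, adOp_sub_left,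
    LinearMap.add_apply, LinearMap.sub_apply, hd _ _ _, hl X Y Z]
  rw [adOp_swap lam Y ((C : End ℂ F) X)]
  abel

theorem mem_range_comp_inl {W : Type*} [AddCommGroup W] [Module ℂ W] {e : (r × F) ≃ₗ[ℂ] W}
    {x : r × F} : e x ∈ LinearMap.range (e.toLinearMap ∘ₗ LinearMap.inl ℂ r F) ↔ x.2 = 0 := by
  constructor
  · rintro ⟨A, hA⟩
    have := e.injective hA
    rw [← this]; rfl
  · intro hx
    exact ⟨x.1, congrArg e (Prod.ext rfl hx.symm)⟩

variable [FiniteDimensional ℂ F]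

theorem reductiveForm_zero_left (c : ℝ) (A : r) : reductiveForm c r 0 A = 0 := by
  simpa using reductiveForm_smul_left c 0 (0 : r) A

variable {W : Type*} [NormedAddCommGroup W] [InnerProductSpace ℂ W]

/-- A model on the space `W` of the semidirect product `r ⋉ lam` with its inner product. -/
structure IsSemidirectModel (c : ℝ) (r : LieSubalgebra ℂ (End ℂ F)) (lam : SkewAlg F)
    (μ : SkewAlg W) (e : (r × F) ≃ₗ[ℂ] W) : Prop where
  scalar_neg : c < 0
  lie : IsLieBracket lam
  derivation : ∀ A : r, IsDerivation lam (A : F →ₗ[ℂ] F)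
  derivation_adjoint : ∀ A : r, IsDerivation lam (LinearMap.adjoint (A : F →ₗ[ℂ] F))
  exists_adjoint : ∀ A : r, ∃ S : r, ∀ B : r,
    (⁅LinearMap.adjoint (A : End ℂ F), (B : End ℂ F)⁆ : End ℂ F) = ⁅(S : End ℂ F), (B : End ℂ F)⁆
  adOp_apply : ∀ x y, adOp μ (e x) (e y) = e (adOp (semidirect r lam) x y)
  inner_apply : ∀ x y, inner ℂ (e x) (e y) = reductiveForm c r y.1 x.1 + inner ℂ x.2 y.2

namespace IsSemidirectModel

variable {c : ℝ} {μ : SkewAlg W} {e : (r × F) ≃ₗ[ℂ] W} (h : IsSemidirectModel c r lam μ e)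

include h

theorem isLieBracket : IsLieBracket μ := by
  intro x y z
  obtain ⟨x, rfl⟩ := e.surjective x
  obtain ⟨y, rfl⟩ := e.surjective y
  obtain ⟨z, rfl⟩ := e.surjective z
  simp only [h.adOp_apply, ← map_add]
  rw [isLieBracket_semidirect h.lie h.derivation]

theorem mem_orthogonal {x : r × F} :
    e x ∈ (LinearMap.range (e.toLinearMap ∘ₗ LinearMap.inl ℂ r F))ᗮ ↔ x.1 = 0 := by
  rw [Submodule.mem_orthogonal]
  constructor
  · intro hx
    have h1 := hx _ ⟨x.1, rfl⟩
    obtain ⟨y, -, h2, h3⟩ := exists_reductiveForm_self h.scalar_neg x.1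
    refine h3 ?_
    have h4 : inner ℂ (e (x.1, 0)) (e x) = 0 := h1
    rw [h.inner_apply, inner_zero_left, add_zero, h2] at h4
    exact_mod_cast h4
  · rintro hx _ ⟨A, rfl⟩
    change inner ℂ (e (A, 0)) (e x) = 0
    rw [h.inner_apply, hx, inner_zero_left, reductiveForm_zero_left, add_zero]

variable [FiniteDimensional ℂ W]

theorem adjoint_adOp {A S : r}
    (hS : ∀ B : r, (⁅LinearMap.adjoint (A : End ℂ F), (B : End ℂ F)⁆ : End ℂ F)
      = ⁅(S : End ℂ F), (B : End ℂ F)⁆) :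
    LinearMap.adjoint (adOp μ (e (A, 0))) =
      e.conj ((LieAlgebra.ad ℂ r S).prodMap (LinearMap.adjoint (A : F →ₗ[ℂ] F))) := by
  symm
  rw [LinearMap.eq_adjoint_iff]
  intro x y
  obtain ⟨x, rfl⟩ := e.surjective x
  obtain ⟨y, rfl⟩ := e.surjective y
  rw [LinearEquiv.conj_apply_apply, LinearEquiv.symm_apply_apply, h.adOp_apply, h.inner_apply,
    h.inner_apply, semidirect_apply]
  simp only [LinearMap.prodMap_apply, LieAlgebra.ad_apply, map_zero, sub_zero, adOp_zero_left,
    LinearMap.zero_apply, add_zero]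
  rw [reductiveForm_lie hS, adjoint_inner_left']

theorem adjoint_adOp_apply {A S : r}
    (hS : ∀ B : r, (⁅LinearMap.adjoint (A : End ℂ F), (B : End ℂ F)⁆ : End ℂ F)
      = ⁅(S : End ℂ F), (B : End ℂ F)⁆) (x : r × F) :
    LinearMap.adjoint (adOp μ (e (A, 0))) (e x) =
      e (⁅S, x.1⁆, LinearMap.adjoint (A : F →ₗ[ℂ] F) x.2) := by
  rw [h.adjoint_adOp hS, LinearEquiv.conj_apply_apply, LinearEquiv.symm_apply_apply]
  rfl

theorem isDerivation_adjoint (A : r) :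
    IsDerivation μ (LinearMap.adjoint (adOp μ (e (A, 0)))) := by
  obtain ⟨S, hS⟩ := h.exists_adjoint A
  intro x y
  obtain ⟨⟨B, X⟩, rfl⟩ := e.surjective x
  obtain ⟨⟨C, Y⟩, rfl⟩ := e.surjective y
  simp only [h.adOp_apply, h.adjoint_adOp_apply hS, ← map_add, semidirect_apply]
  congr 1
  refine Prod.ext (leibniz_lie S B C) ?_
  have hSB : ∀ (B : r) (Y : F), ((⁅S, B⁆ : r) : End ℂ F) Y
      = LinearMap.adjoint (A : F →ₗ[ℂ] F) ((B : End ℂ F) Y)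
        - (B : End ℂ F) (LinearMap.adjoint (A : F →ₗ[ℂ] F) Y) := fun B Y =>
    (LinearMap.congr_fun (hS B) Y).symm
  simp only [Prod.snd_add, hSB, map_add, map_sub, h.derivation_adjoint A _ _]
  abel

theorem isAdjointSplitting :
    IsAdjointSplitting μ (LinearMap.range (e.toLinearMap ∘ₗ LinearMap.inl ℂ r F)) where
  lie := h.isLieBracket
  left_left := by
    rintro _ ⟨A, rfl⟩ _ ⟨B, rfl⟩
    change adOp μ (e (A, 0)) (e (B, 0)) ∈ _
    rw [h.adOp_apply, mem_range_comp_inl, semidirect_apply]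
    simp [adOp_zero_left]
  left_right := by
    rintro _ ⟨A, rfl⟩ X hX
    obtain ⟨X, rfl⟩ := e.surjective X
    rw [h.mem_orthogonal] at hX
    change adOp μ (e (A, 0)) (e X) ∈ _
    rw [h.adOp_apply, h.mem_orthogonal, semidirect_apply, hX, lie_zero]
  right_right := by
    intro X hX Y hY
    obtain ⟨X, rfl⟩ := e.surjective X
    obtain ⟨Y, rfl⟩ := e.surjective Y
    rw [h.mem_orthogonal] at hX
    rw [h.adOp_apply, h.mem_orthogonal, semidirect_apply, hX, zero_lie]
  adjoint := by
    rintro _ ⟨A, rfl⟩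
    exact h.isDerivation_adjoint A

/-- Here -4 (tr (ad B (ad A)^*) + tr (B A^*)) + 2 tr (ad B (ad A)^*) is c times the prescribed form.
This explains the factors 1/2 and -4/c. -/
theorem inner_opR_left_left (A B : r) :
    inner ℂ (e (A, 0)) (opR μ (e (B, 0))) = c * inner ℂ (e (A, 0)) (e (B, 0)) := by
  obtain ⟨S, hS⟩ := h.exists_adjoint A
  have hs := h.isAdjointSplitting
  set g := LinearMap.range (e.toLinearMap ∘ₗ LinearMap.inl ℂ r F) with hg
  let a := stdOrthonormalBasis ℂ g
  have hmem : ∀ A : r, e (A, 0) ∈ g := fun A => ⟨A, rfl⟩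
  let φ : r ≃ₗ[ℂ] g := LinearEquiv.ofInjective (e.toLinearMap ∘ₗ LinearMap.inl ℂ r F)
    (e.injective.comp LinearMap.inl_injective)
  have hφ : ∀ A : r, ((φ A : g) : W) = e (A, 0) := fun _ => rfl
  have had : ∀ B C : r, adOp μ (e (B, 0)) (e (C, 0)) = e (⁅B, C⁆, 0) := fun B C => by
    rw [h.adOp_apply, semidirect_apply]
    simp [adOp_zero_left]
  have hadj : ∀ C : r, LinearMap.adjoint (adOp μ (e (A, 0))) (e (C, 0)) = e (⁅S, C⁆, 0) :=
    fun C => by rw [h.adjoint_adOp_apply hS, map_zero]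
  have h1 : LinearMap.trace ℂ W (LinearMap.adjoint (adOp μ (e (A, 0))) ∘ₗ adOp μ (e (B, 0)))
      = LinearMap.trace ℂ r (LieAlgebra.ad ℂ r S ∘ₗ LieAlgebra.ad ℂ r B)
        + LinearMap.trace ℂ F (LinearMap.adjoint (A : F →ₗ[ℂ] F) ∘ₗ (B : F →ₗ[ℂ] F)) := by
    have h2 : LinearMap.adjoint (adOp μ (e (A, 0))) ∘ₗ adOp μ (e (B, 0))
        = e.conj ((LieAlgebra.ad ℂ r S ∘ₗ LieAlgebra.ad ℂ r B).prodMap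
          (LinearMap.adjoint (A : F →ₗ[ℂ] F) ∘ₗ (B : F →ₗ[ℂ] F))) := by
      refine LinearMap.ext fun x => ?_
      obtain ⟨x, rfl⟩ := e.surjective x
      rw [LinearEquiv.conj_apply_apply, LinearEquiv.symm_apply_apply, LinearMap.comp_apply,
        h.adOp_apply, h.adjoint_adOp_apply hS, semidirect_apply]
      simp [adOp_zero_left]
    rw [h2, LinearMap.trace_conj', LinearMap.trace_prodMap']
  have h3 : ∑ i, inner ℂ (adOp μ (e (A, 0)) (a i)) (adOp μ (e (B, 0)) (a i))
      = LinearMap.trace ℂ r (LieAlgebra.ad ℂ r S ∘ₗ LieAlgebra.ad ℂ r B) := by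
    rw [← LinearMap.trace_conj' _ φ, LinearMap.trace_eq_sum_inner _ a]
    refine Finset.sum_congr rfl fun i _ => ?_
    obtain ⟨C, hC⟩ := φ.surjective (a i)
    rw [← hC, LinearEquiv.conj_apply_apply, LinearEquiv.symm_apply_apply, Submodule.coe_inner,
      hφ, hφ, LinearMap.comp_apply, LieAlgebra.ad_apply, LieAlgebra.ad_apply, ← hadj,
      LinearMap.adjoint_inner_right, had B]
  rw [hs.inner_opR_left_left a (hmem A), h1, h3, h.inner_apply, inner_zero_left, add_zero,
    reductiveForm, traceAdjoint_ad hS, LinearMap.trace_comp_comm' (LieAlgebra.ad ℂ r B),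
    LinearMap.trace_comp_comm' (B : F →ₗ[ℂ] F)]
  have hc : (c : ℂ) ≠ 0 := by exact_mod_cast h.scalar_neg.ne
  field_simp
  ring

/-- Since ad Y has image in F, the trace reduces to tr (A^* ad Y) on F. With Y = DZ one has ad Y =
[D, ad Z], and D commutes with A^*, so the trace vanishes. -/
theorem inner_opR_left_right {D : End ℂ F} (hD : IsDerivation lam D)
    (hR : opR lam = (c : ℂ) • LinearMap.id + D) (hsurj : Function.Surjective D) (A : r) (Y : F) :
    inner ℂ (e (A, 0)) (opR μ (e (0, Y))) = 0 := by
  obtain ⟨S, hS⟩ := h.exists_adjoint A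
  rw [h.isAdjointSplitting.inner_opR_left_right (mem_range_comp_inl.2 rfl) (h.mem_orthogonal.2 rfl)]
  have h1 : LinearMap.adjoint (adOp μ (e (A, 0))) ∘ₗ adOp μ (e (0, Y))
      = (e.toLinearMap ∘ₗ LinearMap.inr ℂ r F) ∘ₗ (LinearMap.adjoint (A : F →ₗ[ℂ] F) ∘ₗ
        LinearMap.snd ℂ r F ∘ₗ e.symm.toLinearMap ∘ₗ adOp μ (e (0, Y))) := by
    refine LinearMap.ext fun x => ?_
    obtain ⟨x, rfl⟩ := e.surjective x
    simp only [LinearMap.comp_apply, LinearEquiv.coe_coe, h.adOp_apply,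
      LinearEquiv.symm_apply_apply, h.adjoint_adOp_apply hS, semidirect_apply, zero_lie, lie_zero]
    rfl
  have h2 : (LinearMap.adjoint (A : F →ₗ[ℂ] F) ∘ₗ LinearMap.snd ℂ r F ∘ₗ
      e.symm.toLinearMap ∘ₗ adOp μ (e (0, Y))) ∘ₗ (e.toLinearMap ∘ₗ LinearMap.inr ℂ r F)
      = LinearMap.adjoint (A : F →ₗ[ℂ] F) ∘ₗ adOp lam Y := by
    refine LinearMap.ext fun X => ?_
    simp only [LinearMap.comp_apply, LinearEquiv.coe_coe, h.adOp_apply,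
      LinearEquiv.symm_apply_apply, semidirect_apply, LinearMap.inr_apply, LinearMap.snd_apply]
    simp
  have hcomm : D * LinearMap.adjoint (A : F →ₗ[ℂ] F)
      = (LinearMap.adjoint (A : F →ₗ[ℂ] F) * D : End ℂ F) := by
    have h3 := opR_comm_of_derivation (h.derivation_adjoint A)
      (by rw [LinearMap.adjoint_adjoint]; exact h.derivation A)
    have h4 : D = opR lam - (c : ℂ) • (1 : End ℂ F) := by
      rw [hR]; exact (add_sub_cancel_left _ _).symm
    rw [h4, sub_mul, mul_sub, h3, smul_mul_assoc, mul_smul_comm, one_mul, mul_one]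
  obtain ⟨Z, rfl⟩ := hsurj Y
  rw [h1, LinearMap.trace_comp_comm', h2, adOp_comm_derivation hD]
  have h5 : LinearMap.trace ℂ F ((LinearMap.adjoint (A : F →ₗ[ℂ] F) : End ℂ F) *
      (D * adOp lam Z - adOp lam Z * D)) = 0 := by
    rw [mul_sub, map_sub, ← mul_assoc, ← hcomm, mul_assoc, LinearMap.trace_mul_comm ℂ D, mul_assoc,
      sub_self]
  exact (congrArg _ h5).trans (mul_zero _)

theorem inner_opR_right_right (X Y : F) :
    inner ℂ (e (0, X)) (opR μ (e (0, Y))) = inner ℂ X (opR lam Y) := by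
  have hs := h.isAdjointSplitting
  set g := LinearMap.range (e.toLinearMap ∘ₗ LinearMap.inl ℂ r F) with hg
  have hmem : ∀ X : F, e (0, X) ∈ gᗮ := fun X => h.mem_orthogonal.2 rfl
  let f : F →ₗ[ℂ] gᗮ := (e.toLinearMap ∘ₗ LinearMap.inr ℂ r F).codRestrict gᗮ hmem
  have hf : Function.Bijective f := by
    constructor
    · intro X Y hXY
      exact (Prod.ext_iff.1 (e.injective (congrArg (fun w : gᗮ => (w : W)) hXY))).2
    · rintro ⟨w, hw⟩
      obtain ⟨x, rfl⟩ := e.surjective w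
      refine ⟨x.2, Subtype.ext ?_⟩
      exact congrArg e (Prod.ext (h.mem_orthogonal.1 hw).symm rfl)
  let f' : F ≃ₗᵢ[ℂ] gᗮ := (LinearEquiv.ofBijective f hf).isometryOfInner fun X Y => by
    change inner ℂ (e (0, X)) (e (0, Y)) = _
    rw [h.inner_apply, reductiveForm_zero_left, zero_add]
  refine hs.inner_opR_right_right (lam := lam) f' (fun X Y => ?_) X Y
  change adOp μ (e (0, X)) (e (0, Y)) = e (0, adOp lam X Y)
  rw [h.adOp_apply, semidirect_apply]
  simp

theorem opR_eq {D : End ℂ F} (hD : IsDerivation lam D)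
    (hR : opR lam = (c : ℂ) • LinearMap.id + D) (hsurj : Function.Surjective D) :
    opR μ = (c : ℂ) • LinearMap.id + e.conj ((0 : r →ₗ[ℂ] r).prodMap D) := by
  have hdec : ∀ x : r × F, e x = e (x.1, 0) + e (0, x.2) := fun x => by
    rw [← map_add]; simp
  have hsym : ∀ x y, inner ℂ (opR μ x) y = inner ℂ x (opR μ y) := fun x y => by
    rw [← adjoint_inner_left', opR_adjoint]
  refine LinearMap.ext fun y => ext_inner_left ℂ fun x => ?_
  obtain ⟨x, rfl⟩ := e.surjective x
  obtain ⟨y, rfl⟩ := e.surjective y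
  have h1 : inner ℂ (e (0, x.2)) (opR μ (e (y.1, 0))) = 0 := by
    rw [← hsym, ← inner_conj_symm, h.inner_opR_left_right hD hR hsurj, map_zero]
  have h2 : inner ℂ (e x) (opR μ (e y)) =
      c * inner ℂ (e (x.1, 0)) (e (y.1, 0)) + inner ℂ x.2 (opR lam y.2) := by
    rw [hdec x, hdec y, map_add, inner_add_left, inner_add_right, inner_add_right, h1,
      h.inner_opR_left_left, h.inner_opR_left_right hD hR hsurj, h.inner_opR_right_right]
    ring
  rw [h2, LinearMap.add_apply, LinearEquiv.conj_apply_apply, LinearEquiv.symm_apply_apply,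
    inner_add_right, LinearMap.smul_apply, LinearMap.id_apply, inner_smul_right, h.inner_apply,
    h.inner_apply, h.inner_apply, hR]
  simp only [LinearMap.prodMap_apply, LinearMap.zero_apply, reductiveForm_zero_left,
    LinearMap.add_apply, LinearMap.smul_apply, LinearMap.id_apply, inner_add_right,
    inner_smul_right, inner_zero_left]
  ring

end IsSemidirectModel

end Semidirect

/-! ### The type of the semidirect product. -/

section SemidirectType

variable {F : Type*} [NormedAddCommGroup F] [InnerProductSpace ℂ F]
  {r : LieSubalgebra ℂ (End ℂ F)} {lam : SkewAlg F}
  {W : Type*} [NormedAddCommGroup W] [InnerProductSpace ℂ W]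

theorem mem_eigenspace_conj_prodMap (e : (r × F) ≃ₗ[ℂ] W) (D : End ℂ F) (a s : ℂ) (x : r × F) :
    e x ∈ End.eigenspace (a • e.conj ((0 : r →ₗ[ℂ] r).prodMap D)) s ↔
      s • x.1 = 0 ∧ x.2 ∈ End.eigenspace (a • D) s := by
  rw [End.mem_eigenspace_iff, End.mem_eigenspace_iff, LinearMap.smul_apply,
    LinearEquiv.conj_apply_apply, LinearEquiv.symm_apply_apply, ← e.map_smul, ← e.map_smul,
    e.injective.eq_iff, Prod.ext_iff]
  simp [eq_comm]

variable [FiniteDimensional ℂ F] [FiniteDimensional ℂ W]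

theorem isCriticalOfType_semidirect {c a : ℝ} {D : End ℂ F} {m : ℕ} {k d : Fin m → ℕ}
    {μ : SkewAlg W} {e : (r × F) ≃ₗ[ℂ] W} (h : IsSemidirectModel c r lam μ e)
    (ht : IsTypeData lam c a D k d) (h0 : lam ≠ 0) (hk : ∀ i, 0 < k i) {d₁ : ℕ}
    (hd : finrank ℂ r = d₁) (hd₁ : 0 < d₁) :
    IsCriticalOfType μ (Fin.cons 0 k : Fin (m + 1) → ℕ) (Fin.cons d₁ d : Fin (m + 1) → ℕ) := by
  have hker : ∀ x, D x = 0 → x = 0 := fun x hx => by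
    have h1 : x ∈ End.eigenspace ((a : ℂ) • D) 0 := ht.eigenspace_zero.2 hx
    rw [ht.eigenspace_eq_bot (fun i hi => (hk i).ne' (by exact_mod_cast hi))] at h1
    simpa using h1
  have hinj : Function.Injective D := (injective_iff_map_eq_zero D).2 hker
  have hsurj : Function.Surjective D := LinearMap.injective_iff_surjective.1 hinj
  have hR := h.opR_eq ht.isDerivation ht.opR_eq hsurj
  have hD : IsDerivation μ (e.conj ((0 : r →ₗ[ℂ] r).prodMap D)) := by
    -- A and A^* are derivations of `lam`, so A commutes with R and hence with D; this makes 0 ⊕ D a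
    -- derivation of the semidirect product.
    have hcomm : ∀ (A : r) (X : F), D ((A : End ℂ F) X) = (A : End ℂ F) (D X) := fun A X => by
      have h3 := opR_comm_of_derivation (h.derivation A) (h.derivation_adjoint A)
      have h4 := LinearMap.congr_fun h3 X
      rw [ht.opR_eq] at h4
      simpa using h4
    intro x y
    obtain ⟨⟨A, X⟩, rfl⟩ := e.surjective x
    obtain ⟨⟨B, Y⟩, rfl⟩ := e.surjective y
    simp only [LinearEquiv.conj_apply_apply, LinearEquiv.symm_apply_apply, h.adOp_apply, ← map_add,
      LinearMap.prodMap_apply, LinearMap.zero_apply, semidirect_apply]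
    congr 1
    refine Prod.ext (by simp) ?_
    simp only [Prod.snd_add, map_add, map_sub, hcomm, ht.isDerivation _ _]
    simp
    abel
  have hμ : μ ≠ 0 := by
    rintro rfl
    refine h0 (adOp_ext fun X Y => ?_)
    have h1 := h.adOp_apply (0, X) (0, Y)
    rw [adOp_zero_apply, semidirect_apply] at h1
    have h2 := (LinearEquiv.map_eq_zero_iff e).1 h1.symm
    rw [adOp_zero_apply]
    simpa using (Prod.ext_iff.1 h2).2
  refine ⟨isCriticalPoint_of_derivation hR hD hμ, c, a, _, hR, hD, ht.a_pos, ?_, fun hne => ?_,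
    ?_, ?_, ?_⟩
  · intro i j
    refine Fin.cases ?_ (fun j => ?_) j
    · exact fun hij => absurd hij (Fin.not_lt_zero i)
    · refine Fin.cases ?_ (fun i => ?_) i
      · exact fun _ => by simpa using hk j
      · exact fun hij => by simpa using ht.k_strictMono (Fin.succ_lt_succ_iff.1 hij)
  · have h1 : D ≠ 0 := by
      rintro rfl
      exact hne (by rw [LinearMap.prodMap_zero, map_zero])
    refine Nat.dvd_one.1 (dvd_trans ?_ (ht.k_coprime h1).dvd)
    exact Finset.dvd_gcd fun i _ =>
      Finset.gcd_dvd (f := (Fin.cons 0 k : Fin (m + 1) → ℕ)) (Finset.mem_univ i.succ)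
  · exact Fin.cases hd₁ ht.d_pos
  · refine Fin.cases ?_ fun i => ?_
    · have h1 : End.eigenspace ((a : ℂ) • e.conj ((0 : r →ₗ[ℂ] r).prodMap D)) ((0 : ℕ) : ℂ)
          = LinearMap.range (e.toLinearMap ∘ₗ LinearMap.inl ℂ r F) := by
        ext x
        obtain ⟨x, rfl⟩ := e.surjective x
        rw [mem_eigenspace_conj_prodMap, mem_range_comp_inl, Nat.cast_zero, zero_smul,
          ht.eigenspace_zero]
        exact ⟨fun hx => hker _ hx.2, fun hx => ⟨rfl, by rw [hx, map_zero]⟩⟩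
      rw [Fin.cons_zero, Fin.cons_zero, h1, ← hd]
      exact LinearMap.finrank_range_of_inj (e.injective.comp LinearMap.inl_injective)
    · have h1 : End.eigenspace ((a : ℂ) • e.conj ((0 : r →ₗ[ℂ] r).prodMap D)) (k i : ℂ)
          = (End.eigenspace ((a : ℂ) • D) (k i : ℂ)).map (e.toLinearMap ∘ₗ LinearMap.inr ℂ r F) := by
        ext x
        obtain ⟨x, rfl⟩ := e.surjective x
        rw [mem_eigenspace_conj_prodMap, smul_eq_zero_iff_right (by exact_mod_cast (hk i).ne')]
        constructor
        · rintro ⟨h2, h3⟩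
          exact ⟨x.2, h3, congrArg e (Prod.ext h2.symm rfl)⟩
        · rintro ⟨y, hy, hyx⟩
          have h2 : ((0 : r), y) = x := e.injective hyx
          rw [← h2]
          exact ⟨rfl, hy⟩
      rw [Fin.cons_succ, Fin.cons_succ, h1, ← ht.finrank_eigenspace i]
      exact (Submodule.equivMapOfInjective _ (show Function.Injective
        (e.toLinearMap ∘ₗ LinearMap.inr ℂ r F) from e.injective.comp LinearMap.inr_injective)
        _).finrank_eq.symm
  · rw [Fin.sum_univ_succ, ← e.finrank_eq, Module.finrank_prod, ← ht.sum_d, hd]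
    simp

end SemidirectType

/-! ### Both directions assembled. -/

theorem theorem4p5
    {E : Type*} [NormedAddCommGroup E] [InnerProductSpace ℂ E] [FiniteDimensional ℂ E]
    {F : Type*} [NormedAddCommGroup F] [InnerProductSpace ℂ F] [FiniteDimensional ℂ F] :
    (∀ (μ : LieBracket E) (r : ℕ) (k d : Fin (r + 1) → ℕ) (c a : ℝ) (D : E →ₗ[ℂ] E)
        (g : Fin (r + 1) → Submodule ℂ E) (n : Submodule ℂ E),
      IsCriticalPoint μ.1 → IsTypeData μ.1 c a D k d → k 0 = 0 →
      (∀ i, g i = Module.End.eigenspace ((a : ℂ) • D) (k i : ℂ)) →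
      n = ⨆ i : Fin r, g i.succ →
      IsNilradical μ n ∧
      Module.finrank ℂ n + d 0 = Module.finrank ℂ E ∧
      (∃ hn : ∀ x ∈ n, ∀ y ∈ n, adOp μ.1 x y ∈ n,
        (restrictAlg μ.1 n hn ≠ 0 →
          IsCriticalOfType (restrictAlg μ.1 n hn) (fun i : Fin r => k i.succ)
            (fun i : Fin r => d i.succ)) ∧
        (restrictAlg μ.1 n hn = 0 → r ≤ 1 ∧ ∀ i : Fin r, k i.succ = 1)) ∧
      IsReductiveSubalgebra μ (g 0) ∧
      (∀ A ∈ g 0, IsDerivation μ.1 (LinearMap.adjoint (adOp μ.1 A)))) ∧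
    (∀ (lam : LieBracket F) (r : ℕ) (k d : Fin r → ℕ) (c a : ℝ) (D : F →ₗ[ℂ] F)
        (rg : LieSubalgebra ℂ (Module.End ℂ F)) (d₁ : ℕ),
      IsCriticalPoint lam.1 → IsTypeData lam.1 c a D k d → LieRing.IsNilpotent (LieAlg lam) →
      LieAlgebra.HasCentralRadical ℂ rg → Module.finrank ℂ rg = d₁ → 0 < d₁ →
      (∀ A ∈ rg, IsDerivation lam.1 A ∧ IsDerivation lam.1 (LinearMap.adjoint A)) →
      (∀ A : rg, A ∈ LieAlgebra.derivedSeries ℂ rg 1 →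
        LinearMap.adjoint (A : F →ₗ[ℂ] F) ∈ rg) →
      (∀ A : rg, A ∈ LieAlgebra.center ℂ rg →
        Commute (A : Module.End ℂ F) (LinearMap.adjoint (A : F →ₗ[ℂ] F))) →
      IsLieBracket (semidirect rg lam.1) ∧
      ∃ ip : InnerProductSpace.Core ℂ (rg × F),
        (∀ x y : rg × F, ip.inner x y = reductiveForm c rg y.1 x.1 + inner ℂ x.2 y.2) ∧
        IsCriticalOfTypeWrt ip (semidirect rg lam.1)
          (Fin.cons 0 k : Fin (r + 1) → ℕ) (Fin.cons d₁ d : Fin (r + 1) → ℕ)) := by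
  refine ⟨fun μ r k d c a D g n hcrit h hk hg hn => ?_,
    fun lam r k d c a D rg d₁ hcrit h hnil hrad hd hd₁ hder hs hz => ?_⟩
  · have hn' : n = ⨆ i : Fin r, End.eigenspace ((a : ℂ) • D) (k i.succ : ℂ) := by
      rw [hn]; exact iSup_congr fun i => hg _
    have hsplit := h.isAdjointSplitting μ.2 hk
    have hng := hn'.trans h.positive_eq_orthogonal
    have hnn : ∀ x ∈ n, ∀ y ∈ n, adOp μ.1 x y ∈ n := by
      rw [hng]; exact hsplit.right_right
    rw [hg 0]
    refine ⟨?_, h.finrank_positive hn', ⟨hnn, fun hne => ?_, fun h0 => ?_⟩,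
      hsplit.isReductiveSubalgebra, hsplit.adjoint⟩
    · rw [hn']; exact h.isNilradical hk hcrit.1
    · have ht := h.isTypeData_restrictAlg μ.2 hk hn' hnn
      exact ⟨isCriticalPoint_of_derivation ht.opR_eq ht.isDerivation hne, c, a, _, ht⟩
    · exact h.eq_one_of_restrictAlg_eq_zero μ.2 hk hn' hnn h0
  · have hc := scalar_neg h.opR_eq h.isDerivation hcrit.1
    refine ⟨isLieBracket_semidirect lam.2 fun A => (hder A A.2).1, semidirectCore hc rg,
      fun _ _ => rfl, ?_⟩
    let : NormedAddCommGroup (rg × F) := (semidirectCore hc rg).toNormedAddCommGroup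
    let : InnerProductSpace ℂ (rg × F) := InnerProductSpace.ofCore (semidirectCore hc rg).toCore
    refine isCriticalOfType_semidirect (W := rg × F) (e := LinearEquiv.refl ℂ (rg × F))
      { scalar_neg := hc
        lie := lam.2
        derivation := fun A => (hder A A.2).1
        derivation_adjoint := fun A => (hder A A.2).2
        exists_adjoint := exists_lie_adjoint_eq hs hz
        adOp_apply := fun _ _ => rfl
        -- Nilpotency of `lam` enters only here, to make all its degrees positive and so D
        -- invertible.
        inner_apply := fun _ _ => rfl } h hcrit.1 (h.pos_of_isNilpotent hcrit.1 hnil) hd hd₁
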